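/- Let $S$ be a compact oriented surface, each component of which has non-empty boundary, and let $h:S\to S$ be a homeomorphism that is the identity on $\partial S$. Let $M=(S,h)$ be the closed 3-manifold with open book $(S,h)$, that is, the quotient of $S\times[0,1]$ by $(x,1)\sim(h(x),0)$ for $x\in S$ and $(x,t)\sim(x,t')$ for $x\in\partial S$; the images of the surfaces $S\times\{t\}$ are the pages, and $M$ carries the product orientation. Let $C$ be a simple closed curve in the interior of a page $S=S\times\{t_0\}$, $0<t_0<1$, which bounds an embedded disc $D$ in $M$. Let $N\cong S^1\times D^2$ be a regular neighbourhood of $C$ in standard position with respect to $S$ and $D$: it is disjoint from the binding and from the page $S\times\{0\}$, it meets the page $S\times\{t_0\}$ in an annular neighbourhood $A$ of $C$ in $S$, which is the horizontal annulus $S^1\times[-1,1]$ of the solid torus, and it meets $D$ in a collar of $\partial D$ consisting of one radius of each meridian disc. On $\partial N$ let $\mu$ be the meridian of $N$, let $\lambda_D$ be the class of the curve $D\cap\partial N$, and let $\lambda_S$ be the common class of the two curves $S\cap\partial N$, where $\lambda_S$ and $\lambda_D$ are oriented parallel to $C$ and $\mu$ is oriented so that it has linking number $+1$ with $C$ (right-hand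 rule). The twisting $tw_C(S)\in\mathbb Z$ is defined by $\lambda_S=\lambda_D+tw_C(S)\,\mu$. Let $T_C$ be the right-handed Dehn twist about $C$, supported in $A$. Suppose that $tw_C(S)=0$, let $q\in\mathbb Z$, and let $Y$ be the result of Dehn surgery on $C$ with slope $-\mu+q\lambda_D$ (equivalently $\mu-q\lambda_D$): the interior of $N$ is removed, and a solid torus $V$ is glued to the exterior by a linear homeomorphism $\partial V\to\partial N$ which takes the meridian of $V$ to a curve of that slope. Then: 1. $Y$ has an open book decomposition given by $(S,T_C^q h)$: there is a homeomorphism $\Phi$ from $Y$ to the manifold $(S,T_C^q h)$. It can be chosen so that on the exterior $M\setminus \mathrm{int}\,N\subset Y$ it takes points of the page $S\times\{t\}$ to points of the page $S\times\{t\}$, for each $t$, and is the identity $(x,t_0)\mapsto(x,t_0)$ on the part of the page $S\times\{t_0\}$ in the exterior. 2. The analogues of $C$, $D$ and $S$ exist in $Y$ as embedded objects, and in $Y$ it remains the case that $tw_C(S)=0$: in $(S,T_C^qh)$ the curve $C\subset S\times\{t_0\}$ bounds an embedded disc $D'$ and has a regular neighbourhood $N'\subset\Phi(V)$, in standard position with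 respect to $S\times\{t_0\}$ and $D'$ and meeting $S\times\{t_0\}$ in a concentric subannulus of $A$, such that $D'\setminus\Phi(V)=\Phi(D\setminus N)$ and the twisting of $S\times\{t_0\}$ along $C$ defined by $D'$ and $N'$ is $0$. -/

import Mathlib

open scoped Manifold

noncomputable section

namespace Stallings

/-! ### Discs, curves and classes of curves on a torus -/

/-- The closed unit disc in `ℂ`. -/
abbrev Disc : Type := Metric.closedBall (0 : ℂ) 1

/-- The point `r • w` of the disc. -/
def Disc.polar (r : unitInterval) (w : Circle) : Disc :=
  ⟨((r : ℝ) : ℂ) * (w : ℂ), by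
    have h0 := r.2.1
    have h1 := r.2.2
    simpa [abs_of_nonneg h0, Circle.norm_coe] using h1⟩

/-- The boundary point `w` of the disc. -/
def Disc.ofCircle (w : Circle) : Disc := Disc.polar 1 w

/-- The point `s` of the horizontal diameter of the disc. -/
def Disc.ofReal (s : Set.Icc (-1 : ℝ) 1) : Disc :=
  ⟨((s : ℝ) : ℂ), by
    have h := abs_le.2 s.2
    simpa using h⟩

/-- The solid torus `S¹ × D²`. -/
abbrev SolidTorus : Type := Circle × Disc

/-- The self-map `f` of the circle has degree `n`. -/
def HasDegree (f : Circle → Circle) (n : ℤ) : Prop :=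
  ∃ φ : ℝ → ℝ, Continuous φ ∧ (∀ t, f (Circle.exp t) = Circle.exp (φ t)) ∧
    ∀ t, φ (t + 2 * Real.pi) = φ t + 2 * Real.pi * n

/-- `H₁` of the torus `S¹ × ∂D²`. The first entry is the coefficient of `{1} × ∂D²`, the second
that of `S¹ × {1}`. -/
abbrev TorusH1 : Type := ℤ × ℤ

/-- The loop `c` in `S¹ × ∂D²` represents the class `v`. -/
def HasClass (c : Circle → Circle × Circle) (v : TorusH1) : Prop :=
  HasDegree (fun u => (c u).2) v.1 ∧ HasDegree (fun u => (c u).1) v.2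

/-- The linear self-map of the torus `S¹ × ∂D²` with integer matrix `B`. -/
def linearTorusMap (B : Matrix (Fin 2) (Fin 2) ℤ) (p : Circle × Circle) : Circle × Circle :=
  (p.1 ^ B 0 0 * p.2 ^ B 0 1, p.1 ^ B 1 0 * p.2 ^ B 1 1)

/-! ### Oriented surfaces -/

/-- A map between planar domains, injective near `z`, preserves orientation at `z`: the images of
small positively oriented circles about `z` wind `+1` times around `f z`. -/
def PreservesOrientationAt (f : ℂ → ℂ) (z : ℂ) : Prop :=
  ∃ R > 0, ∀ r : ℝ, 0 < r → r < R → ∃ φ : ℝ → ℝ, Continuous φ ∧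
    (∀ t : ℝ, f (z + r * (Circle.exp t : ℂ)) ≠ f z ∧
      f (z + r * (Circle.exp t : ℂ)) - f z =
        (‖f (z + r * (Circle.exp t : ℂ)) - f z‖ : ℂ) * (Circle.exp (φ t) : ℂ)) ∧
    φ (2 * Real.pi) = φ 0 + 2 * Real.pi

/-- An orientation of a topological surface with boundary: an atlas of planar charts covering the
interior, with orientation-preserving transition maps. -/
structure SurfaceOrientation (S : Type*) [TopologicalSpace S]
    [ChartedSpace (EuclideanHalfSpace 2) S] where
  charts : Set (OpenPartialHomeomorph S ℂ)
  covers : ∀ x ∈ (𝓡∂ 2).interior S, ∃ e ∈ charts, x ∈ e.source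
  compatible : ∀ e ∈ charts, ∀ e' ∈ charts, ∀ x ∈ e.source ∩ e'.source,
    PreservesOrientationAt (fun z => e' (e.symm z)) (e x)

/-- An annular neighbourhood, in the interior of the surface `S`, of the simple closed curve
parametrized by `γ`, which is the core of the annulus. -/
structure AnnularNbhd {S : Type*} [TopologicalSpace S]
    [ChartedSpace (EuclideanHalfSpace 2) S] (γ : Circle → S) where
  toFun : Circle × Set.Icc (-1 : ℝ) 1 → S
  continuous_toFun : Continuous toFun
  injective_toFun : Function.Injective toFun
  isOpen_image : IsOpen (toFun '' {p | |(p.2 : ℝ)| < 1})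
  mem_interior : ∀ p, toFun p ∈ (𝓡∂ 2).interior S
  core : ∀ u, toFun (u, ⟨0, by norm_num⟩) = γ u

section Surface

variable {S : Type*} [TopologicalSpace S] [ChartedSpace (EuclideanHalfSpace 2) S]

namespace AnnularNbhd

variable {γ : Circle → S} (A : AnnularNbhd γ)

/-- The parametrization `(θ, s) ↦ A (e^{iθ}, s)` of the annulus is positively oriented with
respect to the orientation `o`, the strip `ℝ × (-1, 1)` being oriented as a subset of `ℂ`. -/
def IsPositive (o : SurfaceOrientation S) : Prop :=
  ∀ e ∈ o.charts, ∀ (θ : ℝ) (s : Set.Icc (-1 : ℝ) 1), |(s : ℝ)| < 1 →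
    A.toFun (Circle.exp θ, s) ∈ e.source →
    PreservesOrientationAt
      (fun z => e (A.toFun (Circle.exp z.re, Set.projIcc (-1 : ℝ) 1 (by norm_num) z.im)))
      ⟨θ, s⟩

/-- `A'` is the concentric annulus `A (u, c s)`, for some `0 < c ≤ 1`. -/
def IsShrinkingOf (A' A : AnnularNbhd γ) : Prop :=
  ∃ c : ℝ, 0 < c ∧ c ≤ 1 ∧ ∀ (u : Circle) (s s' : Set.Icc (-1 : ℝ) 1),
    (s' : ℝ) = c * s → A'.toFun (u, s) = A.toFun (u, s')

/-- The `n`-fold twist `(u, s) ↦ (u e^{n π i (s + 1)}, s)` of the standard annulus. -/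
def modelTwist (n : ℤ) (p : Circle × Set.Icc (-1 : ℝ) 1) : Circle × Set.Icc (-1 : ℝ) 1 :=
  (p.1 * Circle.exp (n * (Real.pi * ((p.2 : ℝ) + 1))), p.2)

open Classical in
/-- The twist supported in the annulus, as a map. -/
def twistFun (n : ℤ) (x : S) : S :=
  if h : ∃ p, A.toFun p = x then A.toFun (modelTwist n h.choose) else x

theorem twistFun_apply (n : ℤ) (p : Circle × Set.Icc (-1 : ℝ) 1) :
    A.twistFun n (A.toFun p) = A.toFun (modelTwist n p) := by
  have h : ∃ p', A.toFun p' = A.toFun p := ⟨p, rfl⟩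
  rw [twistFun, dif_pos h, A.injective_toFun h.choose_spec]

theorem twistFun_of_notMem (n : ℤ) {x : S} (hx : x ∉ Set.range A.toFun) :
    A.twistFun n x = x := by
  rw [twistFun, dif_neg]
  exact hx

theorem modelTwist_boundary (n : ℤ) {p : Circle × Set.Icc (-1 : ℝ) 1}
    (hp : ¬ |(p.2 : ℝ)| < 1) : modelTwist n p = p := by
  obtain ⟨u, s, hs⟩ := p
  have h1 : s = 1 ∨ s = -1 := by
    have h2 : |s| ≤ 1 := abs_le.2 hs
    have h3 : |s| = 1 := le_antisymm h2 (not_lt.1 hp)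
    exact eq_or_eq_neg_of_abs_eq h3
  have h4 : Circle.exp (n * (Real.pi * (s + 1))) = 1 := by
    rcases h1 with rfl | rfl
    · rw [Circle.exp_eq_one]
      exact ⟨n, by ring⟩
    · simp
  simp [modelTwist, h4]

theorem twistFun_eqOn (n : ℤ) {x : S} (hx : x ∉ A.toFun '' {p | |(p.2 : ℝ)| < 1}) :
    A.twistFun n x = x := by
  by_cases h : x ∈ Set.range A.toFun
  · obtain ⟨p, rfl⟩ := h
    rw [twistFun_apply, modelTwist_boundary]
    exact fun hp => hx ⟨p, hp, rfl⟩
  · exact A.twistFun_of_notMem n h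

theorem continuous_modelTwist (n : ℤ) : Continuous (modelTwist n) := by
  unfold modelTwist
  fun_prop

theorem continuous_twistFun [T2Space S] (n : ℤ) : Continuous (A.twistFun n) := by
  have hemb : Topology.IsClosedEmbedding A.toFun :=
    A.continuous_toFun.isClosedEmbedding A.injective_toFun
  have h1 : ContinuousOn (A.twistFun n) (Set.range A.toFun) := by
    rw [← Set.image_univ, hemb.isInducing.continuousOn_image_iff]
    have : A.twistFun n ∘ A.toFun = A.toFun ∘ modelTwist n := by
      funext p
      exact A.twistFun_apply n p
    rw [this]
    exact (A.continuous_toFun.comp (continuous_modelTwist n)).continuousOn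
  have h2 : ContinuousOn (A.twistFun n) (A.toFun '' {p | |(p.2 : ℝ)| < 1})ᶜ :=
    continuousOn_id.congr fun x hx => A.twistFun_eqOn n hx
  have h3 := h1.union_of_isClosed h2 hemb.isClosed_range A.isOpen_image.isClosed_compl
  rw [← continuousOn_univ]
  refine h3.mono fun x _ => ?_
  by_cases hx : x ∈ A.toFun '' {p | |(p.2 : ℝ)| < 1}
  · exact Or.inl (Set.image_subset_range _ _ hx)
  · exact Or.inr hx

theorem modelTwist_neg (n : ℤ) (p : Circle × Set.Icc (-1 : ℝ) 1) :
    modelTwist (-n) (modelTwist n p) = p := by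
  obtain ⟨u, s⟩ := p
  simp only [modelTwist, mul_assoc, ← Circle.exp_add]
  simp

theorem twistFun_neg (n : ℤ) (x : S) : A.twistFun (-n) (A.twistFun n x) = x := by
  by_cases h : x ∈ Set.range A.toFun
  · obtain ⟨p, rfl⟩ := h
    rw [twistFun_apply, twistFun_apply, modelTwist_neg]
  · rw [A.twistFun_of_notMem n h, A.twistFun_of_notMem _ h]

/-- The Dehn twist about the core of the annulus,
`A (e^{iθ}, s) ↦ A (e^{i (θ + π (s + 1))}, s)`, extended by the identity. It is the right-handed
Dehn twist for the orientation of `S` for which `(θ, s)` are positive coordinates: an arc which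
crosses the annulus is turned to the right. -/
def dehnTwist [T2Space S] : S ≃ₜ S where
  toFun := A.twistFun 1
  invFun := A.twistFun (-1)
  left_inv := A.twistFun_neg 1
  right_inv := A.twistFun_neg (-1)
  continuous_toFun := A.continuous_twistFun 1
  continuous_invFun := A.continuous_twistFun (-1)

end AnnularNbhd

/-! ### The 3-manifold of an open book -/

/-- The identifications `(x, 1) ∼ (h x, 0)`, and `(x, t) ∼ (x, t')` for `x ∈ ∂S`. -/
inductive OpenBookRel (h : S ≃ₜ S) : S × unitInterval → S × unitInterval → Prop
  | monodromy (x : S) : OpenBookRel h (x, 1) (h x, 0)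
  | binding (x : S) (hx : x ∈ (𝓡∂ 2).boundary S) (t t' : unitInterval) :
      OpenBookRel h (x, t) (x, t')

/-- The closed 3-manifold with open book `(S, h)`: the quotient of `S × [0, 1]` by the relation
above. Its pages are the images of the surfaces `S × {t}`, and its binding is the image of
`∂S × [0, 1]`. -/
def OpenBook (h : S ≃ₜ S) : Type _ := Quot (OpenBookRel h)

instance (h : S ≃ₜ S) : TopologicalSpace (OpenBook h) :=
  inferInstanceAs (TopologicalSpace (Quot (OpenBookRel h)))

/-- The point of the manifold `OpenBook h` which is represented by a point of `S × [0, 1]`. -/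
def OpenBook.mk (h : S ≃ₜ S) (p : S × unitInterval) : OpenBook h := Quot.mk _ p

/-- A regular neighbourhood `S¹ × D²` of the curve `γ` in the page `S × {t₀}`. It avoids the
binding and the page `S × {0}`, so that it is also a subset of `S × [0, 1]`. It meets
`S × {t₀}` in the annulus `A`, which is the horizontal annulus `S¹ × [-1, 1]` of the solid torus,
and the part of the solid torus over the upper half disc is above the page. If `A` is positively
oriented in `S`, then this parametrization is positively oriented in `S × [0, 1]`. -/
structure RegularNbhd {γ : Circle → S} (A : AnnularNbhd γ) (t₀ : unitInterval) where
  toFun : SolidTorus → S × unitInterval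
  continuous_toFun : Continuous toFun
  injective_toFun : Function.Injective toFun
  isOpen_image : IsOpen (toFun '' {p | ‖(p.2 : ℂ)‖ < 1})
  mem_interior : ∀ p, (toFun p).1 ∈ (𝓡∂ 2).interior S
  level_pos : ∀ p, 0 < (toFun p).2
  level_lt_one : ∀ p, (toFun p).2 < 1
  page : ∀ u s, toFun (u, Disc.ofReal s) = (A.toFun (u, s), t₀)
  above : ∀ p : SolidTorus, 0 < (p.2 : ℂ).im → t₀ < (toFun p).2
  below : ∀ p : SolidTorus, (p.2 : ℂ).im < 0 → (toFun p).2 < t₀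

namespace RegularNbhd

variable {γ : Circle → S} {A : AnnularNbhd γ} {t₀ : unitInterval} (N : RegularNbhd A t₀)

/-- The neighbourhood as a subset of the manifold. -/
def carrier (h : S ≃ₜ S) : Set (OpenBook h) :=
  Set.range fun p => OpenBook.mk h (N.toFun p)

/-- The open solid torus. -/
def openCarrier (h : S ≃ₜ S) : Set (OpenBook h) :=
  (fun p => OpenBook.mk h (N.toFun p)) '' {p | ‖(p.2 : ℂ)‖ < 1}

/-- The exterior of the curve. -/
abbrev Exterior (h : S ≃ₜ S) : Type _ := {x : OpenBook h // x ∉ N.openCarrier h}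

/-- The point of `∂N` with coordinates in `S¹ × ∂D²`. -/
def boundaryPoint (h : S ≃ₜ S) (p : Circle × Circle) : OpenBook h :=
  OpenBook.mk h (N.toFun (p.1, Disc.ofCircle p.2))

end RegularNbhd

/-- The meridian `μ` of a regular neighbourhood: the class of `{1} × ∂D²` with its
counterclockwise orientation. -/
def meridian : TorusH1 := (1, 0)

/-- A component, in the coordinates of `∂N`, of the intersection of the page with `∂N`. -/
def pageCurve (u : Circle) : Circle × Circle := (u, 1)

/-- An embedded disc `D` in the manifold `OpenBook h`, bounded by the curve `γ` in the page
`S × {t₀}` and in standard position with respect to the regular neighbourhood `N`: the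
intersection of `D` and `N` is a collar of `∂D` in `D`, and it consists of one radius, in the
direction `dir u`, of each meridian disc `{u} × D²`. -/
structure SpanningDisc {γ : Circle → S} {A : AnnularNbhd γ} {t₀ : unitInterval}
    (h : S ≃ₜ S) (N : RegularNbhd A t₀) where
  toFun : Disc → OpenBook h
  continuous_toFun : Continuous toFun
  injective_toFun : Function.Injective toFun
  dir : Circle → Circle
  continuous_dir : Continuous dir
  collar : ∀ (z : Disc) (u : Circle) (s : unitInterval),
    (z : ℂ) = ((1 - (s : ℝ) / 2 : ℝ) : ℂ) * (u : ℂ) →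
      toFun z = OpenBook.mk h (N.toFun (u, Disc.polar s (dir u)))
  notMem : ∀ z : Disc, ‖(z : ℂ)‖ < 1 / 2 → toFun z ∉ N.carrier h

namespace SpanningDisc

variable {γ : Circle → S} {A : AnnularNbhd γ} {t₀ : unitInterval} {h : S ≃ₜ S}
  {N : RegularNbhd A t₀} (D : SpanningDisc h N)

/-- The curve in which `D` meets `∂N`, in the coordinates of `∂N`, oriented as `γ`. -/
def longitudeCurve (u : Circle) : Circle × Circle := (u, D.dir u)

/-- The twisting of the page along the curve is `n`: `λ_S = λ_D + n μ`. -/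
def HasTwisting (n : ℤ) : Prop :=
  ∃ lamS lamD : TorusH1, HasClass pageCurve lamS ∧ HasClass D.longitudeCurve lamD ∧
    lamS = lamD + n • meridian

end SpanningDisc

/-! ### Dehn surgery -/

/-- The boundary of the new solid torus is glued to `∂N` by the linear map with matrix `B`. -/
inductive SurgeryRel {γ : Circle → S} {A : AnnularNbhd γ} {t₀ : unitInterval}
    (h : S ≃ₜ S) (N : RegularNbhd A t₀) (B : Matrix (Fin 2) (Fin 2) ℤ) :
    N.Exterior h ⊕ SolidTorus → N.Exterior h ⊕ SolidTorus → Prop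
  | glue (x : N.Exterior h) (u w : Circle) (hx : x.1 = N.boundaryPoint h (linearTorusMap B (u, w))) :
      SurgeryRel h N B (Sum.inl x) (Sum.inr (u, Disc.ofCircle w))

/-- The result of Dehn surgery along the curve: the open solid torus is removed and a solid torus
is glued to the exterior by the linear map with matrix `B`. -/
def Surgery {γ : Circle → S} {A : AnnularNbhd γ} {t₀ : unitInterval}
    (h : S ≃ₜ S) (N : RegularNbhd A t₀) (B : Matrix (Fin 2) (Fin 2) ℤ) : Type _ :=
  Quot (SurgeryRel h N B)

/-- `B` is invertible and the meridian of the new solid torus is glued to a curve of slope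
`± v`: the surgery with gluing matrix `B` is a surgery with slope `v`. -/
def IsGluingOfSlope (B : Matrix (Fin 2) (Fin 2) ℤ) (v : TorusH1) : Prop :=
  IsUnit B.det ∧ (HasClass (fun w => linearTorusMap B (1, w)) v ∨
    HasClass (fun w => linearTorusMap B (1, w)) (-v))

namespace Surgery

variable {γ : Circle → S} {A : AnnularNbhd γ} {t₀ : unitInterval}
  (h : S ≃ₜ S) (N : RegularNbhd A t₀) (B : Matrix (Fin 2) (Fin 2) ℤ)

instance : TopologicalSpace (Surgery h N B) :=
  inferInstanceAs (TopologicalSpace (Quot (SurgeryRel h N B)))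

/-- The exterior of the curve as a part of the surgered manifold. -/
def ofExterior (x : N.Exterior h) : Surgery h N B := Quot.mk _ (Sum.inl x)

/-- The glued-in solid torus as a part of the surgered manifold. -/
def newTorus : Set (Surgery h N B) := Set.range fun p : SolidTorus => Quot.mk _ (Sum.inr p)

end Surgery

end Surface

end Stallings

end

noncomputable section

namespace Stallings

/-! ### Degrees -/

/-! Cut `M` along the page `S × {t₀}` and apply `T_C^q` to every level below it. The identification
`(x, 1) ∼ (h x, 0)` becomes `(x, 1) ∼ (T_C^q (h x), 0)`, so this cut map goes bijectively from
`OpenBook h` to the open book with the new monodromy. It is discontinuous at most where the twist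
moves points of the page `S × {t₀}`, that is, inside the open annulus `A`, which lies in the
interior of `N`. On the exterior of `C` it is therefore a homeomorphism onto the exterior of a new
solid torus `N.twist q` (`RegularNbhd.continuousOn_cutMap`).

On `∂N` the cut map is `(u, w) ↦ (u e^{iα(w)}, w)`, where `α` vanishes on the upper half circle and
grows from `0` to `2πq` along the lower one. It is homotopic to `(u, w) ↦ (u w^q, w)`. Twisting zero
gives `λ_D = λ_S`, so the slope `-μ + q λ_D` is sent to `-μ`. The gluing map followed by the cut
thus extends over the solid torus (`SolidTorus.exists_extension`), and the extension together with
the cut map is the homeomorphism `Φ` (`Surgery.exists_homeomorph_openBook`).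

The radius direction `dir` of `D` has degree zero, so it lifts to `ℝ` and can be rotated to the
constant `1`. Performing this rotation in the outer half of `N.twist q` completes the cut image of
`D` outside `N` to a disc bounded by `C`. Near `C` this disc lies in the page annulus, so the
twisting is again zero (`SpanningDisc.twist`). -/

theorem HasDegree.unique {f : Circle → Circle} {m n : ℤ} (hm : HasDegree f m)
    (hn : HasDegree f n) : m = n := by
  obtain ⟨φ, hφ, hfφ, hpφ⟩ := hm
  obtain ⟨ψ, hψ, hfψ, hpψ⟩ := hn
  have hpi : (2 * Real.pi : ℝ) ≠ 0 := by positivity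
  -- Two lifts differ by `2π` times a continuous integer-valued function on `ℝ`, which is constant.
  have h1 : ∀ t, ∃ k : ℤ, φ t = ψ t + k * (2 * Real.pi) := fun t =>
    Circle.exp_eq_exp.1 ((hfφ t).symm.trans (hfψ t))
  choose k hk using h1
  have hkc : Continuous k := by
    rw [Int.isClosedEmbedding_coe_real.isEmbedding.continuous_iff]
    have : (fun t => ((k t : ℤ) : ℝ)) = fun t => (φ t - ψ t) / (2 * Real.pi) := by
      funext t
      rw [hk t]
      field_simp
      ring
    change Continuous fun t => ((k t : ℤ) : ℝ)
    rw [this]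
    fun_prop
  have hconst : k (0 + 2 * Real.pi) = k 0 := PreconnectedSpace.constant inferInstance hkc
  have h2 := hpφ 0
  rw [hk, hk 0, hpψ, hconst] at h2
  have h3 : (2 * Real.pi) * (n : ℝ) = 2 * Real.pi * m := by linarith
  exact_mod_cast (mul_left_cancel₀ hpi h3).symm

theorem hasDegree_zpow (n : ℤ) : HasDegree (fun u => u ^ n) n :=
  ⟨fun t => n * t, by fun_prop, fun t =>
    (Circle.exp_intCast_mul t n).symm, fun t => by ring⟩

theorem hasDegree_id : HasDegree (fun u => u) 1 := by simpa using hasDegree_zpow 1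

theorem hasDegree_const_one : HasDegree (fun _ => 1) 0 := by simpa using hasDegree_zpow 0

/-- A self-map of the circle of degree zero lifts to `ℝ`. -/
theorem HasDegree.exists_lift {f : Circle → Circle} (hf : HasDegree f 0) :
    ∃ φ : Circle → ℝ, Continuous φ ∧ ∀ u, f u = Circle.exp (φ u) := by
  obtain ⟨φ, hφ, hfφ, hpφ⟩ := hf
  have hper : Function.Periodic φ (2 * Real.pi) := fun t => by simpa using hpφ t
  have hsurj : Function.Surjective Circle.exp := fun u => ⟨_, Circle.exp_arg u⟩
  have hq : Topology.IsQuotientMap Circle.exp :=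
    (isLocalHomeomorph_circleExp.isOpenMap).isQuotientMap Circle.exp.continuous hsurj
  -- `arg` jumps at `-1`, but only by a period of `φ`; continuity is tested after pulling back along
  -- the quotient map `Circle.exp`.
  have hval : ∀ t, φ (Circle.exp t : ℂ).arg = φ t := fun t => by
    obtain ⟨k, hk⟩ := Circle.exp_eq_exp.1 (Circle.exp_arg (Circle.exp t))
    rw [hk]
    exact hper.int_mul k t
  refine ⟨fun u => φ (u : ℂ).arg, hq.continuous_iff.2 ?_, fun u => ?_⟩
  · exact hφ.congr fun t => (hval t).symm
  · rw [← hfφ, Circle.exp_arg]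

/-! ### Homeomorphisms of the solid torus -/

namespace Disc

/-- Rotation of the disc. -/
def rotate (v : Circle) (z : Disc) : Disc :=
  ⟨v * z, by
    have h := z.2
    simp only [Metric.mem_closedBall, dist_zero_right] at h
    simpa [Circle.norm_coe] using h⟩

/-- Reflection of the disc in its horizontal diameter. -/
def conj (z : Disc) : Disc :=
  ⟨starRingEnd ℂ z, by
    have h := z.2
    simp only [Metric.mem_closedBall, dist_zero_right] at h
    simpa using h⟩

theorem norm_le_one (z : Disc) : ‖(z : ℂ)‖ ≤ 1 :=
  mem_closedBall_zero_iff.1 z.2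

@[simp] theorem coe_ofCircle (w : Circle) : (ofCircle w : ℂ) = w := by
  simp [ofCircle, polar]

@[simp] theorem coe_polar (r : unitInterval) (w : Circle) :
    (polar r w : ℂ) = ((r : ℝ) : ℂ) * (w : ℂ) := rfl

@[simp] theorem coe_rotate (v : Circle) (z : Disc) : (rotate v z : ℂ) = v * z := rfl

@[simp] theorem coe_conj (z : Disc) : (conj z : ℂ) = starRingEnd ℂ z := rfl

theorem norm_polar (r : unitInterval) (w : Circle) : ‖(polar r w : ℂ)‖ = r := by
  rw [coe_polar, norm_mul, Circle.norm_coe, mul_one, Complex.norm_real, Real.norm_eq_abs,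
    abs_of_nonneg r.2.1]

theorem continuous_ofCircle : Continuous ofCircle := by
  refine Continuous.subtype_mk ?_ _
  fun_prop

theorem ofCircle_injective : Function.Injective ofCircle := fun v w h => by
  have := congrArg (fun z : Disc => (z : ℂ)) h
  simp only [coe_ofCircle] at this
  exact Circle.ext this

theorem exists_polar (z : Disc) : ∃ (r : unitInterval) (w : Circle), z = polar r w := by
  refine ⟨⟨‖(z : ℂ)‖, norm_nonneg _, z.norm_le_one⟩, Circle.exp (z : ℂ).arg, ?_⟩
  apply Subtype.ext
  simp [Circle.coe_exp]

theorem eq_ofCircle_of_norm_eq_one {z : Disc} (hz : ‖(z : ℂ)‖ = 1) :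
    ∃ w : Circle, z = ofCircle w := by
  obtain ⟨r, w, rfl⟩ := z.exists_polar
  rw [norm_polar] at hz
  exact ⟨w, by rw [ofCircle, show r = 1 from Subtype.ext hz]⟩

end Disc

namespace SolidTorus

/-- The homeomorphism `(u, z) ↦ (u ^ e, u ^ c J z)` of the solid torus, for an involution `J`. -/
def linear (e c : ℤ) (he : e * e = 1) (J : Disc → Disc) (hJ : Continuous J)
    (hJJ : ∀ z, J (J z) = z) : SolidTorus ≃ₜ SolidTorus where
  toFun p := (p.1 ^ e, Disc.rotate (p.1 ^ c) (J p.2))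
  invFun p := (p.1 ^ e, J (Disc.rotate (p.1 ^ (-(e * c))) p.2))
  left_inv p := by
    obtain ⟨u, z⟩ := p
    have h1 : (u ^ e) ^ e = u := by rw [← zpow_mul, he, zpow_one]
    have h2 : (u ^ e) ^ (-(e * c)) = (u ^ c)⁻¹ := by
      rw [← zpow_mul, mul_neg, ← mul_assoc, he, one_mul, zpow_neg]
    refine Prod.ext h1 ?_
    simp only
    rw [h2]
    conv_rhs => rw [← hJJ z]
    congr 1
    apply Subtype.ext
    simp [-Circle.coe_zpow]
  right_inv p := by
    obtain ⟨u, z⟩ := p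
    have h1 : (u ^ e) ^ e = u := by rw [← zpow_mul, he, zpow_one]
    refine Prod.ext h1 ?_
    simp only
    rw [hJJ, ← zpow_mul, zpow_neg]
    apply Subtype.ext
    simp [-Circle.coe_zpow]
  continuous_toFun := by
    refine (by fun_prop : Continuous fun p : SolidTorus => p.1 ^ e).prodMk
      (Continuous.subtype_mk ?_ _)
    exact (continuous_subtype_val.comp (by fun_prop : Continuous fun p : SolidTorus => p.1 ^ c)).mul
      (by fun_prop)
  continuous_invFun := by
    refine (by fun_prop : Continuous fun p : SolidTorus => p.1 ^ e).prodMk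
      (hJ.comp (Continuous.subtype_mk ?_ _))
    exact (continuous_subtype_val.comp
      (by fun_prop : Continuous fun p : SolidTorus => p.1 ^ (-(e * c)))).mul (by fun_prop)

/-- The homeomorphism `(u, z) ↦ (u e^{i g(z)}, z)` of the solid torus. -/
def shear (g : Disc → ℝ) (hg : Continuous g) : SolidTorus ≃ₜ SolidTorus where
  toFun p := (p.1 * Circle.exp (g p.2), p.2)
  invFun p := (p.1 * Circle.exp (-g p.2), p.2)
  left_inv p := by simp [mul_assoc]
  right_inv p := by simp [mul_assoc]
  continuous_toFun := by fun_prop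
  continuous_invFun := by fun_prop

/-- The angle of the twist which is applied to the lower half of the solid torus. -/
def cutAngle (q : ℤ) (z : ℂ) : ℝ := if 0 ≤ z.im then 0 else q * (Real.pi * (z.re + 1))

/-- The twist of the lower half of the solid torus. It is not continuous at the horizontal
annulus. -/
def cut (q : ℤ) (p : SolidTorus) : SolidTorus :=
  (p.1 * Circle.exp (cutAngle q p.2), p.2)

theorem cutAngle_neg (q : ℤ) (z : ℂ) : cutAngle (-q) z = -cutAngle q z := by
  unfold cutAngle
  split_ifs <;> simp

theorem cut_neg_cut (q : ℤ) (p : SolidTorus) : cut (-q) (cut q p) = p := by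
  simp [cut, cutAngle_neg, mul_assoc]

theorem cut_cut_neg (q : ℤ) (p : SolidTorus) : cut q (cut (-q) p) = p := by
  simpa using cut_neg_cut (-q) p

theorem cut_injective (q : ℤ) : Function.Injective (cut q) :=
  Function.LeftInverse.injective (cut_neg_cut q)

@[simp] theorem cut_snd (q : ℤ) (p : SolidTorus) : (cut q p).2 = p.2 := rfl

theorem cut_of_nonneg (q : ℤ) {p : SolidTorus} (hp : 0 ≤ (p.2 : ℂ).im) : cut q p = p := by
  simp [cut, cutAngle, hp]

/-- The difference between the angle of the cut and the angle on the circle. -/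
theorem exists_cutAngle_eq : ∃ δ : Circle → ℝ, Continuous δ ∧ ∀ (q : ℤ) (w : Circle),
    Circle.exp (cutAngle q w) = w ^ q * Circle.exp (q * δ w) := by
  -- With `a ∈ (-π, π]` the argument of `w`, this is `cutAngle 1 w - a` on the upper half circle and
  -- `cutAngle 1 w - a - 2π` on the lower one. The correction `2π` makes the branches agree: both
  -- are `0` at `1` and `-π` at `-1`.
  refine ⟨fun w => if 0 ≤ (w : ℂ).im then -Real.arccos (w : ℂ).re else
    Real.pi * ((w : ℂ).re - 1) + Real.arccos (w : ℂ).re, ?_, fun q w => ?_⟩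
  · refine Continuous.if_le ?_ ?_ continuous_const ?_ fun w hw => ?_
    · exact (Real.continuous_arccos.comp (Complex.continuous_re.comp continuous_subtype_val)).neg
    · exact (continuous_const.mul ((Complex.continuous_re.comp continuous_subtype_val).sub
        continuous_const)).add
        (Real.continuous_arccos.comp (Complex.continuous_re.comp continuous_subtype_val))
    · exact Complex.continuous_im.comp continuous_subtype_val
    · have h1 : (w : ℂ).re ^ 2 + (w : ℂ).im ^ 2 = 1 := by
        have := Circle.normSq_coe w
        rw [Complex.normSq_apply] at this
        linarith
      rw [← hw] at h1
      have h2 : (w : ℂ).re = 1 ∨ (w : ℂ).re = -1 := by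
        rw [← sq_eq_one_iff]
        linarith
      rcases h2 with h2 | h2 <;> rw [h2]
      · simp
      · rw [Real.arccos_neg_one]
        ring
  · have hw : ∃ a : ℝ, w = Circle.exp a ∧ Real.arccos (w : ℂ).re = |a| ∧ (0 ≤ (w : ℂ).im → 0 ≤ a) ∧
        (¬ 0 ≤ (w : ℂ).im → a < 0) := by
      refine ⟨(w : ℂ).arg, (Circle.exp_arg w).symm, ?_, Complex.arg_nonneg_iff.2, fun h =>
        Complex.arg_neg_iff.2 (not_le.1 h)⟩
      have h1 : (w : ℂ).re = Real.cos (w : ℂ).arg := by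
        rw [Complex.cos_arg (Circle.coe_ne_zero w), Circle.norm_coe, div_one]
      rw [h1, ← Real.cos_abs, Real.arccos_cos (abs_nonneg _) (Complex.abs_arg_le_pi _)]
    obtain ⟨a, ha, hcos, hp, hn⟩ := hw
    have hz : w ^ q = Circle.exp (q * a) := by rw [ha, Circle.exp_intCast_mul]
    rw [hz, ← Circle.exp_add, cutAngle]
    beta_reduce
    split_ifs with h
    · rw [hcos, abs_of_nonneg (hp h)]
      congr 1
      ring
    · rw [hcos, abs_of_neg (hn h), Circle.exp_eq_exp]
      exact ⟨q, by ring⟩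

/-- On the unit circle the angle jumps only at `w = 1`, by `2πq`, which the exponential does not
see. Inside the disc the jump across the diameter is not a multiple of `2π` in general. -/
theorem continuous_exp_cutAngle (q : ℤ) :
    Continuous fun w : Circle => Circle.exp (cutAngle q w) := by
  obtain ⟨δ, hδ, h⟩ := exists_cutAngle_eq
  simp only [h q]
  fun_prop

/-- If the linear map `B` takes the meridian to a curve of slope `-μ + q λ`, then the composition
of `B` and the `q`-fold cut extends to the solid torus. -/
theorem exists_extension (q : ℤ) (B : Matrix (Fin 2) (Fin 2) ℤ)
    (hB : IsGluingOfSlope B (-1, q)) :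
    ∃ Ψ : SolidTorus ≃ₜ SolidTorus, (∀ p, ‖((Ψ p).2 : ℂ)‖ = ‖(p.2 : ℂ)‖) ∧
      ∀ u w, Ψ (u, Disc.ofCircle w) =
        cut q ((linearTorusMap B (u, w)).1, Disc.ofCircle (linearTorusMap B (u, w)).2) := by
  obtain ⟨hdet, hcl⟩ := hB
  have h11 : HasDegree (fun w => (linearTorusMap B (1, w)).2) (B 1 1) := by
    simpa [linearTorusMap] using hasDegree_zpow (B 1 1)
  have h01 : HasDegree (fun w => (linearTorusMap B (1, w)).1) (B 0 1) := by
    simpa [linearTorusMap] using hasDegree_zpow (B 0 1)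
  -- The second column of `B` is the image of the meridian, hence `±(-1, q)`, with the coefficient
  -- of `μ` in the lower entry.
  have hd : (B 1 1 = 1 ∨ B 1 1 = -1) ∧ B 0 1 + B 1 1 * q = 0 := by
    rcases hcl with ⟨h1, h2⟩ | ⟨h1, h2⟩
    · rw [h11.unique h1, h01.unique h2]
      simp
    · rw [h11.unique h1, h01.unique h2]
      simp
  obtain ⟨hd1, hd2⟩ := hd
  -- After substituting `B 0 1 = -(B 1 1 * q)`, the determinant factors as `B 1 1 * (B 0 0 + B 1 0 *
  -- q)`, and it is a unit.
  have he : (B 0 0 + B 1 0 * q) * (B 0 0 + B 1 0 * q) = 1 := by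
    rw [Matrix.det_fin_two, Int.isUnit_iff] at hdet
    have hb : B 0 1 = -(B 1 1 * q) := by linarith
    rw [hb] at hdet
    rcases hd1 with h | h <;> rw [h] at hdet <;> rcases hdet with h' | h'
    · have : B 0 0 + B 1 0 * q = 1 := by linarith
      rw [this]; rfl
    · have : B 0 0 + B 1 0 * q = -1 := by linarith
      rw [this]; rfl
    · have : B 0 0 + B 1 0 * q = -1 := by linarith
      rw [this]; rfl
    · have : B 0 0 + B 1 0 * q = 1 := by linarith
      rw [this]; rfl
  have hJ : ∃ J : Disc → Disc, Continuous J ∧ (∀ z, J (J z) = z) ∧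
      (∀ z, ‖(J z : ℂ)‖ = ‖(z : ℂ)‖) ∧
      ∀ w, J (Disc.ofCircle w) = Disc.ofCircle (w ^ B 1 1) := by
    rcases hd1 with h | h <;> rw [h]
    · exact ⟨id, continuous_id, fun _ => rfl, fun _ => rfl, fun w => by simp⟩
    · refine ⟨Disc.conj, Continuous.subtype_mk (by fun_prop) _, fun z => Subtype.ext (by simp),
        fun z => by simp, fun w => Subtype.ext ?_⟩
      rw [zpow_neg_one, Disc.coe_conj, Disc.coe_ofCircle, Disc.coe_ofCircle, Circle.coe_inv_eq_conj]
  obtain ⟨J, hJc, hJJ, hJn, hJw⟩ := hJ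
  obtain ⟨δ, hδ, hcut⟩ := exists_cutAngle_eq
  have hemb : Topology.IsClosedEmbedding Disc.ofCircle :=
    Disc.continuous_ofCircle.isClosedEmbedding Disc.ofCircle_injective
  -- The powers of `w` cancel in the first coordinate, so the only non-linear term left is the real
  -- angle `q * δ`; Tietze extends `δ` over the disc.
  obtain ⟨Δ, hΔ⟩ := ContinuousMap.exists_extension hemb ⟨δ, hδ⟩
  have hΔ' : ∀ w, Δ (Disc.ofCircle w) = δ w := fun w => DFunLike.congr_fun hΔ w
  refine ⟨(linear (B 0 0 + B 1 0 * q) (B 1 0) he J hJc hJJ).trans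
    (shear (fun z => q * Δ z) (by fun_prop)), fun p => ?_, fun u w => ?_⟩
  · change ‖(Disc.rotate (p.1 ^ B 1 0) (J p.2) : ℂ)‖ = _
    rw [Disc.coe_rotate, norm_mul, Circle.norm_coe, one_mul, hJn]
  · have h2 : Disc.rotate (u ^ B 1 0) (J (Disc.ofCircle w)) =
        Disc.ofCircle (u ^ B 1 0 * w ^ B 1 1) := by
      rw [hJw]
      apply Subtype.ext
      simp
    change (u ^ (B 0 0 + B 1 0 * q) * Circle.exp (q * Δ (Disc.rotate (u ^ B 1 0)
      (J (Disc.ofCircle w)))), Disc.rotate (u ^ B 1 0) (J (Disc.ofCircle w))) = _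
    rw [h2, hΔ']
    refine Prod.ext ?_ rfl
    simp only [cut, linearTorusMap, Disc.coe_ofCircle]
    rw [hcut, ← mul_assoc]
    congr 1
    rw [mul_zpow, ← zpow_mul, ← zpow_mul, zpow_add, mul_mul_mul_comm, ← zpow_add w, hd2,
      zpow_zero, mul_one]

end SolidTorus

variable {S : Type*} [TopologicalSpace S] [ChartedSpace (EuclideanHalfSpace 2) S]

/-- Serves to shrink annuli and solid tori: a set relatively open in the open set `f '' U` is open.
-/
theorem isOpen_image_of_subset {X Y : Type*} [TopologicalSpace X] [TopologicalSpace Y]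
    {f : X → Y} (hf : Topology.IsInducing f) {U V : Set X} (hU : IsOpen (f '' U))
    (hV : IsOpen V) (hVU : V ⊆ U) : IsOpen (f '' V) := by
  obtain ⟨W, hW, rfl⟩ := hf.isOpen_iff.1 hV
  have : f '' (f ⁻¹' W) = W ∩ f '' U := by
    rw [Set.image_preimage_eq_inter_range]
    refine Set.Subset.antisymm ?_ (Set.inter_subset_inter_right _ (Set.image_subset_range _ _))
    rintro _ ⟨hw, x, rfl⟩
    exact ⟨hw, x, hVU hw, rfl⟩
  rw [this]
  exact hW.inter hU

/-! ### Powers of the Dehn twist -/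

namespace AnnularNbhd

variable {γ : Circle → S} (A : AnnularNbhd γ)

theorem modelTwist_add (m n : ℤ) (p : Circle × Set.Icc (-1 : ℝ) 1) :
    modelTwist (m + n) p = modelTwist m (modelTwist n p) := by
  obtain ⟨u, s⟩ := p
  simp only [modelTwist, mul_assoc, ← Circle.exp_add]
  congr 3
  push_cast
  ring

theorem twistFun_add (m n : ℤ) (x : S) :
    A.twistFun (m + n) x = A.twistFun m (A.twistFun n x) := by
  by_cases h : x ∈ Set.range A.toFun
  · obtain ⟨p, rfl⟩ := h
    rw [twistFun_apply, twistFun_apply, twistFun_apply, modelTwist_add]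
  · rw [A.twistFun_of_notMem _ h, A.twistFun_of_notMem _ h, A.twistFun_of_notMem _ h]

theorem twistFun_zero (x : S) : A.twistFun 0 x = x := by
  have h := A.twistFun_neg 0 x
  rwa [neg_zero, ← A.twistFun_add, add_zero] at h

theorem twistFun_neg_right (n : ℤ) (x : S) : A.twistFun n (A.twistFun (-n) x) = x := by
  rw [← A.twistFun_add, add_neg_cancel, A.twistFun_zero]

theorem dehnTwist_zpow_apply [T2Space S] (q : ℤ) (x : S) :
    (A.dehnTwist ^ q) x = A.twistFun q x := by
  induction q using Int.induction_on generalizing x with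
  | zero => exact (A.twistFun_zero x).symm
  | succ n ih =>
    rw [zpow_add_one, A.twistFun_add, ← ih]
    rfl
  | pred n ih =>
    rw [zpow_sub_one, sub_eq_add_neg, A.twistFun_add, ← ih]
    rfl

theorem twistFun_mem_interior (q : ℤ) {x : S} (hx : x ∈ (𝓡∂ 2).interior S) :
    A.twistFun q x ∈ (𝓡∂ 2).interior S := by
  by_cases h : x ∈ Set.range A.toFun
  · obtain ⟨p, rfl⟩ := h
    rw [twistFun_apply]
    exact A.mem_interior _
  · rwa [A.twistFun_of_notMem _ h]

theorem twistFun_of_mem_boundary (q : ℤ) {x : S} (hx : x ∈ (𝓡∂ 2).boundary S) :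
    A.twistFun q x = x := by
  refine A.twistFun_of_notMem q ?_
  rintro ⟨p, rfl⟩
  exact Set.disjoint_left.1 (𝓡∂ 2).disjoint_interior_boundary (A.mem_interior p) hx

/-- The twist, applied to the part of `S × [0, 1]` below the page `S × {t₀}`. -/
def cutFun (t₀ : unitInterval) (q : ℤ) (p : S × unitInterval) : S × unitInterval :=
  (if t₀ ≤ p.2 then p.1 else A.twistFun q p.1, p.2)

variable (t₀ : unitInterval)

theorem cutFun_of_le (q : ℤ) {p : S × unitInterval} (hp : t₀ ≤ p.2) : A.cutFun t₀ q p = p := by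
  simp [cutFun, hp]

theorem cutFun_of_lt (q : ℤ) {p : S × unitInterval} (hp : p.2 < t₀) :
    A.cutFun t₀ q p = (A.twistFun q p.1, p.2) := by
  simp [cutFun, not_le.2 hp]

theorem cutFun_neg_cutFun (q : ℤ) (p : S × unitInterval) :
    A.cutFun t₀ (-q) (A.cutFun t₀ q p) = p := by
  rcases le_or_gt t₀ p.2 with h | h
  · rw [A.cutFun_of_le t₀ q h, A.cutFun_of_le t₀ _ h]
  · rw [A.cutFun_of_lt t₀ q h, A.cutFun_of_lt t₀ (-q) (p := (A.twistFun q p.1, p.2)) h,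
      A.twistFun_neg]

theorem cutFun_injective (q : ℤ) : Function.Injective (A.cutFun t₀ q) :=
  Function.LeftInverse.injective (A.cutFun_neg_cutFun t₀ q)

theorem cutFun_fst_mem_interior (q : ℤ) {p : S × unitInterval}
    (hp : p.1 ∈ (𝓡∂ 2).interior S) : (A.cutFun t₀ q p).1 ∈ (𝓡∂ 2).interior S := by
  unfold cutFun
  split_ifs
  · exact hp
  · exact A.twistFun_mem_interior q hp

/-- Multiplication by `1 / 2` on `[-1, 1]`. -/
def halve (s : Set.Icc (-1 : ℝ) 1) : Set.Icc (-1 : ℝ) 1 :=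
  ⟨(s : ℝ) / 2, by
    have h1 := s.2.1
    have h2 := s.2.2
    constructor <;> linarith⟩

theorem coe_halve (s : Set.Icc (-1 : ℝ) 1) : (halve s : ℝ) = s / 2 := rfl

theorem continuous_halve : Continuous halve :=
  Continuous.subtype_mk (by fun_prop) _

/-- The concentric annulus of half the width. -/
def half [T2Space S] : AnnularNbhd γ where
  toFun p := A.toFun (p.1, halve p.2)
  continuous_toFun := A.continuous_toFun.comp
    (continuous_fst.prodMk (continuous_halve.comp continuous_snd))
  injective_toFun p p' h := by
    have h1 := A.injective_toFun h
    have h2 : (p.2 : ℝ) / 2 = p'.2 / 2 := congrArg (fun x => (x.2 : ℝ)) h1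
    exact Prod.ext (congrArg (fun x => x.1) h1) (Subtype.ext (by linarith))
  isOpen_image := by
    have hV : IsOpen {p : Circle × Set.Icc (-1 : ℝ) 1 | |(p.2 : ℝ)| < 1 / 2} :=
      isOpen_lt (by fun_prop) continuous_const
    have h := isOpen_image_of_subset
      (A.continuous_toFun.isClosedEmbedding A.injective_toFun).isInducing A.isOpen_image hV
      fun p (hp : |(p.2 : ℝ)| < 1 / 2) => hp.trans (by norm_num)
    convert h using 1
    ext x
    constructor
    · rintro ⟨⟨u, s⟩, hs, rfl⟩
      refine ⟨_, ?_, rfl⟩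
      simp only [Set.mem_ofPred_eq, coe_halve, abs_div, abs_two] at hs ⊢
      linarith
    · rintro ⟨⟨u, s⟩, hs, rfl⟩
      simp only [Set.mem_ofPred_eq] at hs
      have hs' := abs_lt.1 hs
      refine ⟨(u, ⟨2 * s, by constructor <;> linarith⟩), ?_, ?_⟩
      · simp only [Set.mem_ofPred_eq, abs_mul, abs_two]
        linarith
      · refine congrArg A.toFun (Prod.ext rfl (Subtype.ext ?_))
        simp [coe_halve]
  mem_interior p := A.mem_interior _
  core u := by
    rw [← A.core]
    refine congrArg A.toFun (Prod.ext rfl (Subtype.ext ?_))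
    simp [coe_halve]

end AnnularNbhd

/-! ### Regular neighbourhoods -/

namespace Disc

@[simp] theorem coe_ofReal (s : Set.Icc (-1 : ℝ) 1) : (ofReal s : ℂ) = ((s : ℝ) : ℂ) := rfl

theorem exists_ofReal {z : Disc} (hz : (z : ℂ).im = 0) : ∃ s, z = ofReal s := by
  refine ⟨⟨(z : ℂ).re, abs_le.1 ((Complex.abs_re_le_norm _).trans z.norm_le_one)⟩,
    Subtype.ext ?_⟩
  apply Complex.ext <;> simp [hz]

/-- Multiplication by `1 / 2` on the disc. -/
def halve (z : Disc) : Disc :=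
  ⟨(z : ℂ) / 2, by
    have h := z.norm_le_one
    rw [mem_closedBall_zero_iff, norm_div, Complex.norm_ofNat]
    linarith⟩

@[simp] theorem coe_halve (z : Disc) : (halve z : ℂ) = z / 2 := rfl

theorem continuous_halve : Continuous halve := Continuous.subtype_mk (by fun_prop) _

end Disc

namespace RegularNbhd

variable {γ : Circle → S} {A : AnnularNbhd γ} {t₀ : unitInterval} (N : RegularNbhd A t₀)

theorem zero_lt_level (N : RegularNbhd A t₀) : 0 < t₀ := by
  have h := N.level_pos (1, Disc.ofReal ⟨0, by norm_num⟩)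
  rwa [N.page] at h

theorem le_level {p : SolidTorus} (hp : 0 ≤ (p.2 : ℂ).im) : t₀ ≤ (N.toFun p).2 := by
  obtain ⟨u, z⟩ := p
  rcases hp.lt_or_eq with h | h
  · exact (N.above _ h).le
  · obtain ⟨s, rfl⟩ := Disc.exists_ofReal (z := z) h.symm
    rw [N.page]

theorem isClosedEmbedding [T2Space S] : Topology.IsClosedEmbedding N.toFun :=
  N.continuous_toFun.isClosedEmbedding N.injective_toFun

/-- The twist of the whole solid torus. -/
def fullTwist (q : ℤ) (p : SolidTorus) : SolidTorus :=
  (p.1 * Circle.exp (q * (Real.pi * ((p.2 : ℂ).re + 1))), p.2)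

theorem continuous_fullTwist (q : ℤ) : Continuous (fullTwist q) := by
  unfold fullTwist
  fun_prop

theorem fullTwist_neg_right (q : ℤ) (p : SolidTorus) : fullTwist q (fullTwist (-q) p) = p := by
  simp only [fullTwist, mul_assoc, ← Circle.exp_add]
  simp

theorem cut_of_neg (q : ℤ) {p : SolidTorus} (hp : (p.2 : ℂ).im < 0) :
    SolidTorus.cut q p = fullTwist q p := by
  simp [SolidTorus.cut, SolidTorus.cutAngle, fullTwist, not_le.2 hp]

/-- The parametrization of the solid torus which is obtained when the part of it below the page is
twisted. -/
def twistFun (q : ℤ) (p : SolidTorus) : S × unitInterval :=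
  A.cutFun t₀ q (N.toFun (SolidTorus.cut (-q) p))

theorem twistFun_of_nonneg (q : ℤ) {p : SolidTorus} (hp : 0 ≤ (p.2 : ℂ).im) :
    N.twistFun q p = N.toFun p := by
  rw [twistFun, SolidTorus.cut_of_nonneg _ hp, A.cutFun_of_le t₀ q (N.le_level hp)]

/-- The right side is continuous, and it still agrees with `N` on the horizontal annulus: there
`fullTwist (-q)` is the model twist of `A`, which `A.twistFun q` undoes. Hence the discontinuities
of the two cuts cancel. -/
theorem twistFun_of_nonpos (q : ℤ) {p : SolidTorus} (hp : (p.2 : ℂ).im ≤ 0) :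
    N.twistFun q p = Prod.map (A.twistFun q) id (N.toFun (fullTwist (-q) p)) := by
  rcases hp.lt_or_eq with h | h
  · rw [twistFun, cut_of_neg _ h, A.cutFun_of_lt t₀ q (N.below (fullTwist (-q) p) h)]
    rfl
  · obtain ⟨u, z⟩ := p
    obtain ⟨s, rfl⟩ := Disc.exists_ofReal (z := z) h
    rw [N.twistFun_of_nonneg q h.ge, N.page]
    have h2 : fullTwist (-q) (u, Disc.ofReal s) =
        ((AnnularNbhd.modelTwist (-q) (u, s)).1, Disc.ofReal s) := by
      simp [fullTwist, AnnularNbhd.modelTwist]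
    rw [h2, N.page, Prod.map_apply]
    have h3 : ((AnnularNbhd.modelTwist (-q) (u, s)).1, s) = AnnularNbhd.modelTwist (-q) (u, s) :=
      rfl
    rw [h3, ← A.twistFun_apply, A.twistFun_neg_right]
    rfl

theorem continuous_twistFun [T2Space S] (q : ℤ) : Continuous (N.twistFun q) := by
  have h : N.twistFun q = fun p => if 0 ≤ (p.2 : ℂ).im then N.toFun p else
      Prod.map (A.twistFun q) id (N.toFun (fullTwist (-q) p)) := by
    funext p
    split_ifs with hp
    · exact N.twistFun_of_nonneg q hp
    · exact N.twistFun_of_nonpos q (not_le.1 hp).le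
  rw [h]
  refine Continuous.if_le N.continuous_toFun ?_ continuous_const (by fun_prop) fun p hp => ?_
  · exact ((A.continuous_twistFun q).prodMap continuous_id).comp
      (N.continuous_toFun.comp (continuous_fullTwist _))
  · rw [← N.twistFun_of_nonpos q hp.ge, N.twistFun_of_nonneg q hp.le]

theorem isOpen_image_twistFun [T2Space S] (q : ℤ) :
    IsOpen (N.twistFun q '' {p | ‖(p.2 : ℂ)‖ < 1}) := by
  set W := N.toFun '' {p | ‖(p.2 : ℂ)‖ < 1}
  -- The first factor constrains only the levels from `t₀` up, the second only those up to `t₀`.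
  -- Both are open, and at level `t₀` they impose the same condition.
  have h1 : N.twistFun q '' {p | ‖(p.2 : ℂ)‖ < 1} =
      (W ∪ {x | x.2 < t₀}) ∩ (Prod.map (A.twistFun (-q)) id ⁻¹' W ∪ {x | t₀ < x.2}) := by
    ext x
    constructor
    · rintro ⟨p, hp, rfl⟩
      constructor
      · rcases le_or_gt 0 (p.2 : ℂ).im with h | h
        · rw [N.twistFun_of_nonneg q h]
          exact Or.inl ⟨p, hp, rfl⟩
        · rw [N.twistFun_of_nonpos q h.le]
          exact Or.inr (N.below _ h)
      · rcases le_or_gt (p.2 : ℂ).im 0 with h | h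
        · rw [N.twistFun_of_nonpos q h]
          refine Or.inl ⟨fullTwist (-q) p, hp, ?_⟩
          simp [Prod.map, A.twistFun_neg]
        · rw [N.twistFun_of_nonneg q h.le]
          exact Or.inr (N.above _ h)
    · rintro ⟨h1, h2⟩
      rcases le_or_gt t₀ x.2 with h | h
      · rcases h1 with ⟨p, hp, rfl⟩ | h1
        · have : 0 ≤ (p.2 : ℂ).im := not_lt.1 fun h' => not_lt.2 h (N.below p h')
          exact ⟨p, hp, N.twistFun_of_nonneg q this⟩
        · exact absurd h1 (not_lt.2 h)
      · rcases h2 with ⟨p, hp, hpx⟩ | h2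
        · have hx2 : (N.toFun p).2 = x.2 := by rw [hpx]; rfl
          have h3 : (p.2 : ℂ).im ≤ 0 := not_lt.1 fun h' =>
            lt_asymm h (hx2 ▸ N.above p h')
          refine ⟨fullTwist q p, hp, ?_⟩
          rw [N.twistFun_of_nonpos q (p := fullTwist q p) h3]
          have h4 : fullTwist (-q) (fullTwist q p) = p := by
            simpa using fullTwist_neg_right (-q) p
          rw [h4, hpx]
          simp [Prod.map, A.twistFun_neg_right]
        · exact absurd h2 (not_lt.2 h.le)
  rw [h1]
  refine (N.isOpen_image.union (isOpen_lt continuous_snd continuous_const)).inter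
    ((N.isOpen_image.preimage ?_).union (isOpen_lt continuous_const continuous_snd))
  exact (A.continuous_twistFun _).prodMap continuous_id

/-- The regular neighbourhood which is obtained when the part below the page is twisted. -/
def twist [T2Space S] (q : ℤ) : RegularNbhd A t₀ where
  toFun := N.twistFun q
  continuous_toFun := N.continuous_twistFun q
  injective_toFun :=
    (A.cutFun_injective t₀ q).comp (N.injective_toFun.comp (SolidTorus.cut_injective _))
  isOpen_image := N.isOpen_image_twistFun q
  mem_interior p := A.cutFun_fst_mem_interior t₀ q (N.mem_interior _)
  level_pos p := N.level_pos _
  level_lt_one p := N.level_lt_one _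
  page u s := by rw [N.twistFun_of_nonneg q (by simp), N.page]
  above p hp := N.above _ hp
  below p hp := N.below _ hp

/-- In the coordinates of `N` and `N.twist q`, the cut of the open book is the explicit
`SolidTorus.cut`. -/
theorem cutFun_toFun [T2Space S] (q : ℤ) (p : SolidTorus) :
    A.cutFun t₀ q (N.toFun p) = (N.twist q).toFun (SolidTorus.cut q p) := by
  change _ = A.cutFun t₀ q (N.toFun (SolidTorus.cut (-q) (SolidTorus.cut q p)))
  rw [SolidTorus.cut_neg_cut]

theorem cutFun_neg_twist_toFun [T2Space S] (q : ℤ) (p : SolidTorus) :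
    A.cutFun t₀ (-q) ((N.twist q).toFun p) = N.toFun (SolidTorus.cut (-q) p) :=
  A.cutFun_neg_cutFun t₀ q _

/-- The concentric solid torus of half the radius. -/
def half [T2Space S] : RegularNbhd A.half t₀ where
  toFun p := N.toFun (p.1, Disc.halve p.2)
  continuous_toFun := N.continuous_toFun.comp
    (continuous_fst.prodMk (Disc.continuous_halve.comp continuous_snd))
  injective_toFun p p' h := by
    have h1 := N.injective_toFun h
    have h2 : (p.2 : ℂ) / 2 = p'.2 / 2 := congrArg (fun x => (x.2 : ℂ)) h1
    refine Prod.ext (congrArg (fun x => x.1) h1) (Subtype.ext ?_)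
    simpa using h2
  isOpen_image := by
    have hV : IsOpen {p : SolidTorus | ‖(p.2 : ℂ)‖ < 1 / 2} :=
      isOpen_lt (by fun_prop) continuous_const
    have h := isOpen_image_of_subset N.isClosedEmbedding.isInducing N.isOpen_image hV
      fun p (hp : ‖(p.2 : ℂ)‖ < 1 / 2) => hp.trans (by norm_num)
    convert h using 1
    ext x
    constructor
    · rintro ⟨⟨u, z⟩, hz, rfl⟩
      refine ⟨_, ?_, rfl⟩
      simp only [Set.mem_ofPred_eq, Disc.coe_halve, norm_div, Complex.norm_ofNat] at hz ⊢
      linarith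
    · rintro ⟨⟨u, z⟩, hz, rfl⟩
      simp only [Set.mem_ofPred_eq] at hz
      have hz2 : ‖(2 * z : ℂ)‖ < 1 := by
        rw [norm_mul, Complex.norm_ofNat]
        linarith
      refine ⟨(u, ⟨2 * z, mem_closedBall_zero_iff.2 hz2.le⟩), hz2, ?_⟩
      refine congrArg N.toFun (Prod.ext rfl (Subtype.ext ?_))
      simp
  mem_interior p := N.mem_interior _
  level_pos p := N.level_pos _
  level_lt_one p := N.level_lt_one _
  page u s := by
    have h : Disc.halve (Disc.ofReal s) = Disc.ofReal (AnnularNbhd.halve s) :=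
      Subtype.ext (by simp [AnnularNbhd.coe_halve])
    rw [h, N.page]
    rfl
  above p hp := N.above _ (by simpa using hp)
  below p hp := N.below _ (by
    change ((p.2 : ℂ) / 2).im < 0
    rw [Complex.div_ofNat_im]
    linarith)

end RegularNbhd

/-! ### The cut map between open books -/

namespace OpenBook

/-- Such a `p` is on neither side of any generating relation, so being equal to `p` is a predicate
that descends to the quotient. -/
theorem eq_of_mk_eq (h : S ≃ₜ S) {p p' : S × unitInterval} (hp : p.1 ∈ (𝓡∂ 2).interior S)
    (h0 : 0 < p.2) (h1 : p.2 < 1) (hpp' : mk h p' = mk h p) : p' = p := by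
  have key : ∀ a b, OpenBookRel h a b → (a = p) = (b = p) := by
    rintro _ _ (x | ⟨x, hx, t, t'⟩)
    · refine propext ⟨?_, ?_⟩
      · rintro rfl
        exact absurd h1 (lt_irrefl _)
      · rintro rfl
        exact absurd h0 (lt_irrefl _)
    · have hxp : x ≠ p.1 := fun hx' =>
        Set.disjoint_left.1 (𝓡∂ 2).disjoint_interior_boundary (hx' ▸ hp) hx
      refine propext ⟨?_, ?_⟩ <;> rintro rfl <;> exact absurd rfl hxp
  have h2 : Quot.lift (fun a => a = p) key (mk h p') = Quot.lift (fun a => a = p) key (mk h p) :=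
    congrArg _ hpp'
  exact h2.mpr rfl

theorem continuous_mk (h : S ≃ₜ S) : Continuous (mk h) := continuous_quot_mk

theorem isClosed_iff (h : S ≃ₜ S) {K : Set (OpenBook h)} :
    IsClosed K ↔ IsClosed (mk h ⁻¹' K) :=
  isQuotientMap_quot_mk.isClosed_preimage.symm

/-- The map of open books which is induced by the twist of the part below the page `S × {t₀}`. -/
def cutMap {γ : Circle → S} (A : AnnularNbhd γ) {t₀ : unitInterval} (ht₀ : 0 < t₀) (q : ℤ)
    {h h' : S ≃ₜ S} (hh' : ∀ x, h' x = A.twistFun q (h x)) : OpenBook h → OpenBook h' :=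
  Quot.map (A.cutFun t₀ q) fun a b hab => by
    obtain x | ⟨x, hx, t, t'⟩ := hab
    · rw [A.cutFun_of_le t₀ q unitInterval.le_one', A.cutFun_of_lt t₀ q ht₀, ← hh']
      exact OpenBookRel.monodromy x
    · have key : ∀ t, A.cutFun t₀ q (x, t) = (x, t) := fun t => by
        simp [AnnularNbhd.cutFun, A.twistFun_of_mem_boundary q hx]
      rw [key, key]
      exact OpenBookRel.binding x hx t t'

section cutMap

variable {γ : Circle → S} {A : AnnularNbhd γ} {t₀ : unitInterval} (ht₀ : 0 < t₀) (q : ℤ)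
  {h h' : S ≃ₜ S} (hh' : ∀ x, h' x = A.twistFun q (h x))

theorem cutMap_mk (p : S × unitInterval) :
    cutMap A ht₀ q hh' (mk h p) = mk h' (A.cutFun t₀ q p) := rfl

theorem cutMap_cutMap {q q' : ℤ} (hq : q' = -q) (hh' : ∀ x, h' x = A.twistFun q (h x))
    (hh : ∀ x, h x = A.twistFun q' (h' x)) (b : OpenBook h) :
    cutMap A ht₀ q' hh (cutMap A ht₀ q hh' b) = b := by
  subst hq
  obtain ⟨p, rfl⟩ := Quot.exists_rep b
  change mk h (A.cutFun t₀ (-q) (A.cutFun t₀ q p)) = mk h p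
  rw [A.cutFun_neg_cutFun]

end cutMap

end OpenBook

/-! ### Solid tori inside open books, and the cut map on their exteriors -/

namespace RegularNbhd

variable {γ : Circle → S} {A : AnnularNbhd γ} {t₀ : unitInterval} (N : RegularNbhd A t₀)

theorem mk_eq_mk_toFun_iff (h : S ≃ₜ S) {x : S × unitInterval} {p : SolidTorus} :
    OpenBook.mk h x = OpenBook.mk h (N.toFun p) ↔ x = N.toFun p :=
  ⟨OpenBook.eq_of_mk_eq h (N.mem_interior p) (N.level_pos p) (N.level_lt_one p),
    congrArg _⟩

theorem mk_toFun_injective (h : S ≃ₜ S) :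
    Function.Injective fun p => OpenBook.mk h (N.toFun p) := fun _ _ hp =>
  N.injective_toFun ((N.mk_eq_mk_toFun_iff h).1 hp)

theorem preimage_mk_image (h : S ≃ₜ S) (K : Set SolidTorus) :
    OpenBook.mk h ⁻¹' ((fun p => OpenBook.mk h (N.toFun p)) '' K) = N.toFun '' K := by
  ext x
  constructor
  · rintro ⟨p, hp, hpx⟩
    exact ⟨p, hp, ((N.mk_eq_mk_toFun_iff h).1 hpx.symm).symm⟩
  · rintro ⟨p, hp, rfl⟩
    exact ⟨p, hp, rfl⟩

theorem continuous_mk_toFun (h : S ≃ₜ S) : Continuous fun p => OpenBook.mk h (N.toFun p) :=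
  (OpenBook.continuous_mk h).comp N.continuous_toFun

theorem isClosedMap_mk_toFun [T2Space S] (h : S ≃ₜ S) :
    IsClosedMap fun p => OpenBook.mk h (N.toFun p) := fun K hK => by
  rw [OpenBook.isClosed_iff, N.preimage_mk_image]
  exact N.isClosedEmbedding.isClosedMap K hK

theorem mk_toFun_mem_openCarrier (h : S ≃ₜ S) {p : SolidTorus} :
    OpenBook.mk h (N.toFun p) ∈ N.openCarrier h ↔ ‖(p.2 : ℂ)‖ < 1 :=
  (N.mk_toFun_injective h).mem_set_image

theorem isOpen_openCarrier (h : S ≃ₜ S) : IsOpen (N.openCarrier h) := by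
  refine isQuotientMap_quot_mk.isOpen_preimage.1 ?_
  exact (N.preimage_mk_image h _).symm ▸ N.isOpen_image

/-- The two formulas need only agree at level `t₀`, where removing the open solid torus has removed
every point of the open annulus; the twist fixes all others. -/
theorem continuousOn_cutFun [T2Space S] (q : ℤ) :
    ContinuousOn (A.cutFun t₀ q) (N.toFun '' {p | ‖(p.2 : ℂ)‖ < 1})ᶜ := by
  set X := (N.toFun '' {p | ‖(p.2 : ℂ)‖ < 1})ᶜ
  have hX : IsClosed X := N.isOpen_image.isClosed_compl
  have h1 : ContinuousOn (A.cutFun t₀ q) (X ∩ {x | t₀ ≤ x.2}) :=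
    continuousOn_id.congr fun x hx => A.cutFun_of_le t₀ q hx.2
  have h2 : ContinuousOn (A.cutFun t₀ q) (X ∩ {x | x.2 ≤ t₀}) := by
    refine ((A.continuous_twistFun q).prodMap continuous_id).continuousOn.congr fun x hx => ?_
    obtain ⟨y, t⟩ := x
    rcases (show t ≤ t₀ from hx.2).lt_or_eq with h | h
    · exact A.cutFun_of_lt t₀ q h
    · subst h
      rw [A.cutFun_of_le t q le_rfl]
      refine Prod.ext (A.twistFun_eqOn q ?_).symm rfl
      rintro ⟨⟨u, s⟩, hs, rfl⟩
      refine hx.1 ⟨(u, Disc.ofReal s), ?_, N.page u s⟩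
      simpa using hs
  have h3 := h1.union_of_isClosed h2 (hX.inter (isClosed_le continuous_const continuous_snd))
    (hX.inter (isClosed_le continuous_snd continuous_const))
  refine h3.mono fun x hx => ?_
  rcases le_total t₀ x.2 with h | h
  · exact Or.inl ⟨hx, h⟩
  · exact Or.inr ⟨hx, h⟩

theorem continuousOn_cutMap [T2Space S] (q : ℤ) {h h' : S ≃ₜ S} (ht₀ : 0 < t₀)
    (hh' : ∀ x, h' x = A.twistFun q (h x)) :
    ContinuousOn (OpenBook.cutMap A ht₀ q hh') (N.openCarrier h)ᶜ := by
  rw [continuousOn_iff_isClosed]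
  intro K hK
  refine ⟨OpenBook.cutMap A ht₀ q hh' ⁻¹' K ∩ (N.openCarrier h)ᶜ, ?_, by
    rw [Set.inter_assoc, Set.inter_self]⟩
  rw [OpenBook.isClosed_iff]
  have h1 : OpenBook.mk h ⁻¹' (OpenBook.cutMap A ht₀ q hh' ⁻¹' K ∩ (N.openCarrier h)ᶜ) =
      (N.toFun '' {p | ‖(p.2 : ℂ)‖ < 1})ᶜ ∩ A.cutFun t₀ q ⁻¹' (OpenBook.mk h' ⁻¹' K) := by
    rw [Set.inter_comm, Set.preimage_inter, Set.preimage_compl, openCarrier, N.preimage_mk_image]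
    rfl
  rw [h1]
  exact (N.continuousOn_cutFun q).preimage_isClosed_of_isClosed N.isOpen_image.isClosed_compl
    (hK.preimage (OpenBook.continuous_mk h'))

theorem cutMap_mk_toFun [T2Space S] (q : ℤ) {h h' : S ≃ₜ S} (ht₀ : 0 < t₀)
    (hh' : ∀ x, h' x = A.twistFun q (h x)) (p : SolidTorus) :
    OpenBook.cutMap A ht₀ q hh' (OpenBook.mk h (N.toFun p)) =
      OpenBook.mk h' ((N.twist q).toFun (SolidTorus.cut q p)) := by
  rw [OpenBook.cutMap_mk, N.cutFun_toFun]

theorem cutMap_neg_mk_twist [T2Space S] (q : ℤ) {h h' : S ≃ₜ S} (ht₀ : 0 < t₀)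
    (hh : ∀ x, h x = A.twistFun (-q) (h' x)) (p : SolidTorus) :
    OpenBook.cutMap A ht₀ (-q) hh (OpenBook.mk h' ((N.twist q).toFun p)) =
      OpenBook.mk h (N.toFun (SolidTorus.cut (-q) p)) := by
  rw [OpenBook.cutMap_mk, N.cutFun_neg_twist_toFun]

end RegularNbhd

namespace RegularNbhd

variable {γ : Circle → S} {A : AnnularNbhd γ} {t₀ : unitInterval} (N : RegularNbhd A t₀)

section cutMap

variable (q : ℤ) {h h' : S ≃ₜ S} (hh' : ∀ x, h' x = A.twistFun q (h x))

theorem monodromy_eq_twistFun_neg {q : ℤ} (hh' : ∀ x, h' x = A.twistFun q (h x)) (x : S) :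
    h x = A.twistFun (-q) (h' x) := by
  rw [hh', A.twistFun_neg]

theorem cutMap_injective (ht₀ : 0 < t₀) :
    Function.Injective (OpenBook.cutMap A ht₀ q hh') :=
  Function.LeftInverse.injective
    (OpenBook.cutMap_cutMap ht₀ rfl hh' (monodromy_eq_twistFun_neg hh'))

variable [T2Space S]

theorem cutMap_eq_mk_twist_iff {b : OpenBook h} {p : SolidTorus} :
    OpenBook.cutMap A N.zero_lt_level q hh' b = OpenBook.mk h' ((N.twist q).toFun p) ↔
      b = OpenBook.mk h (N.toFun (SolidTorus.cut (-q) p)) := by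
  constructor
  · intro hb
    rw [← N.cutMap_neg_mk_twist q N.zero_lt_level (monodromy_eq_twistFun_neg hh'), ← hb,
      OpenBook.cutMap_cutMap _ rfl]
  · rintro rfl
    rw [N.cutMap_mk_toFun, SolidTorus.cut_cut_neg]

theorem cutMap_mem_openCarrier_iff {b : OpenBook h} :
    OpenBook.cutMap A N.zero_lt_level q hh' b ∈ (N.twist q).openCarrier h' ↔
      b ∈ N.openCarrier h := by
  constructor
  · rintro ⟨p, hp, hpb⟩
    exact ⟨SolidTorus.cut (-q) p, hp, ((N.cutMap_eq_mk_twist_iff q hh').1 hpb.symm).symm⟩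
  · rintro ⟨p, hp, rfl⟩
    exact ⟨SolidTorus.cut q p, hp, (N.cutMap_mk_toFun q N.zero_lt_level hh' p).symm⟩

theorem cutMap_mem_carrier_iff {b : OpenBook h} :
    OpenBook.cutMap A N.zero_lt_level q hh' b ∈ (N.twist q).carrier h' ↔
      b ∈ N.carrier h := by
  constructor
  · rintro ⟨p, hpb⟩
    exact ⟨_, ((N.cutMap_eq_mk_twist_iff q hh').1 hpb.symm).symm⟩
  · rintro ⟨p, rfl⟩
    exact ⟨_, (N.cutMap_mk_toFun q N.zero_lt_level hh' p).symm⟩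

end cutMap

end RegularNbhd

/-! ### The surgered manifold -/

namespace Surgery

variable {γ : Circle → S} {A : AnnularNbhd γ} {t₀ : unitInterval}

/-- If the gluing map, composed with the cut, extends to the solid torus, then the surgered manifold
is homeomorphic to the open book with the twisted monodromy. -/
theorem exists_homeomorph_openBook [T2Space S] {h h' : S ≃ₜ S} (N : RegularNbhd A t₀)
    (B : Matrix (Fin 2) (Fin 2) ℤ) (q : ℤ) (hh' : ∀ x, h' x = A.twistFun q (h x))
    (Ψ : SolidTorus ≃ₜ SolidTorus) (hΨ : ∀ p, ‖((Ψ p).2 : ℂ)‖ = ‖(p.2 : ℂ)‖)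
    (hΨB : ∀ u w, Ψ (u, Disc.ofCircle w) = SolidTorus.cut q
      ((linearTorusMap B (u, w)).1, Disc.ofCircle (linearTorusMap B (u, w)).2)) :
    ∃ Φ : Surgery h N B ≃ₜ OpenBook h',
      (∀ x, Φ (ofExterior h N B x) = OpenBook.cutMap A N.zero_lt_level q hh' x.1) ∧
      Φ '' newTorus h N B = (N.twist q).carrier h' := by
  set c := OpenBook.cutMap A N.zero_lt_level q hh' with hc
  let f : N.Exterior h ⊕ SolidTorus → OpenBook h' :=
    Sum.elim (fun x => c x.1) fun p => OpenBook.mk h' ((N.twist q).toFun (Ψ p))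
  have hf : ∀ a b, SurgeryRel h N B a b → f a = f b := by
    rintro _ _ ⟨x, u, w, hx⟩
    change c x.1 = OpenBook.mk h' ((N.twist q).toFun (Ψ (u, Disc.ofCircle w)))
    rw [hx, hΨB]
    exact N.cutMap_mk_toFun q N.zero_lt_level hh' _
  let F : Surgery h N B → OpenBook h' := Quot.lift f hf
  have hfc : Continuous f := by
    refine Continuous.sumElim ?_ ?_
    · exact continuousOn_iff_continuous_domRestrict.1
        (N.continuousOn_cutMap q N.zero_lt_level hh')
    · exact ((N.twist q).continuous_mk_toFun h').comp Ψ.continuous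
  have hFc : Continuous F := continuous_quot_lift hf hfc
  have hglue : ∀ (x : N.Exterior h) (p : SolidTorus), f (Sum.inl x) = f (Sum.inr p) →
      (Quot.mk _ (Sum.inl x) : Surgery h N B) = Quot.mk _ (Sum.inr p) := by
    rintro x ⟨u, z⟩ hxp
    have hx := (N.cutMap_eq_mk_twist_iff q hh').1 hxp
    -- `Ψ` and the cut preserve the radius, so a point of the new solid torus can meet the exterior
    -- only from its boundary.
    have hz : ‖(z : ℂ)‖ = 1 := by
      refine le_antisymm z.norm_le_one (not_lt.1 fun hlt => x.2 ?_)
      rw [hx, N.mk_toFun_mem_openCarrier, SolidTorus.cut_snd, hΨ]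
      exact hlt
    obtain ⟨w, rfl⟩ := Disc.eq_ofCircle_of_norm_eq_one hz
    rw [hΨB, SolidTorus.cut_neg_cut] at hx
    exact Quot.sound (SurgeryRel.glue x u w hx)
  have hinj : Function.Injective F := by
    intro a b hab
    obtain ⟨a, rfl⟩ := Quot.exists_rep a
    obtain ⟨b, rfl⟩ := Quot.exists_rep b
    change f a = f b at hab
    rcases a with x | p <;> rcases b with y | p'
    · rw [Subtype.ext (RegularNbhd.cutMap_injective q hh' N.zero_lt_level hab)]
    · exact hglue x p' hab
    · exact (hglue y p hab.symm).symm
    · rw [Ψ.injective ((N.twist q).mk_toFun_injective h' hab)]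
  have himage : F '' newTorus h N B = (N.twist q).carrier h' := by
    ext b
    constructor
    · rintro ⟨_, ⟨p, rfl⟩, rfl⟩
      exact ⟨Ψ p, rfl⟩
    · rintro ⟨p, rfl⟩
      refine ⟨_, ⟨Ψ.symm p, rfl⟩, ?_⟩
      change OpenBook.mk h' ((N.twist q).toFun (Ψ (Ψ.symm p))) = _
      rw [Ψ.apply_symm_apply]
  have hh := RegularNbhd.monodromy_eq_twistFun_neg hh'
  have hcc : ∀ b, c (OpenBook.cutMap A N.zero_lt_level (-q) hh b) = b :=
    OpenBook.cutMap_cutMap N.zero_lt_level (neg_neg q).symm hh hh'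
  have hcc' : ∀ b, OpenBook.cutMap A N.zero_lt_level (-q) hh (c b) = b :=
    OpenBook.cutMap_cutMap N.zero_lt_level rfl hh' hh
  have hsurj : Function.Surjective F := by
    intro b
    by_cases hb : b ∈ (N.twist q).carrier h'
    · rw [← himage] at hb
      exact Set.mem_range_of_mem_image _ _ hb
    · refine ⟨Quot.mk _ (Sum.inl ⟨OpenBook.cutMap A N.zero_lt_level (-q) hh b, fun hb' => hb ?_⟩),
        hcc b⟩
      rw [← N.cutMap_mem_openCarrier_iff q hh', ← hc, hcc] at hb'
      exact Set.image_subset_range _ _ hb'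
  -- Closedness is checked directly on the two pieces: on the exterior `F` is inverted by the
  -- opposite cut map, continuous on a closed set, and the solid torus embeds by a closed map. Thus
  -- the open book need not be known to be Hausdorff.
  have hclosed : IsClosedMap F := by
    intro K hK
    have hK' : IsClosed ((Quot.mk _ : _ → Surgery h N B) ⁻¹' K) := hK.preimage continuous_quot_mk
    have h1 : F '' K = ((N.twist q).openCarrier h')ᶜ ∩
          OpenBook.cutMap A N.zero_lt_level (-q) hh ⁻¹'
            (Subtype.val '' {x : N.Exterior h | (Quot.mk _ (Sum.inl x) : Surgery h N B) ∈ K}) ∪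
        (fun p => OpenBook.mk h' ((N.twist q).toFun p)) ''
          (Ψ '' {p | (Quot.mk _ (Sum.inr p) : Surgery h N B) ∈ K}) := by
      ext b
      constructor
      · rintro ⟨a, ha, rfl⟩
        obtain ⟨x | p, rfl⟩ := Quot.exists_rep a
        · refine Or.inl ⟨fun hx => x.2 ((N.cutMap_mem_openCarrier_iff q hh').1 hx), x, ha, ?_⟩
          exact (hcc' x.1).symm
        · exact Or.inr ⟨_, ⟨p, ha, rfl⟩, rfl⟩
      · rintro (⟨-, x, hx, hxb⟩ | ⟨_, ⟨p, hp, rfl⟩, rfl⟩)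
        · refine ⟨_, hx, ?_⟩
          change c x.1 = b
          rw [hxb, hcc]
        · exact ⟨_, hp, rfl⟩
    rw [h1]
    refine IsClosed.union ?_ ?_
    · refine ((N.twist q).continuousOn_cutMap (-q) N.zero_lt_level
        hh).preimage_isClosed_of_isClosed ((N.twist q).isOpen_openCarrier h').isClosed_compl ?_
      exact (N.isOpen_openCarrier h).isClosed_compl.isClosedEmbedding_subtypeVal.isClosedMap _
        (hK'.preimage continuous_inl)
    · exact (N.twist q).isClosedMap_mk_toFun h' _
        (Ψ.isClosedMap _ (hK'.preimage continuous_inr))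
  refine ⟨(Equiv.ofBijective F ⟨hinj, hsurj⟩).toHomeomorphOfContinuousClosed hFc hclosed,
    fun x => rfl, himage⟩

end Surgery

/-! ### The disc in the surgered manifold -/

namespace Disc

/-- The direction of a point of the plane. -/
def direction (z : ℂ) : Circle := Circle.exp z.arg

theorem norm_mul_direction (z : ℂ) : (‖z‖ : ℂ) * (direction z : ℂ) = z := by
  rw [direction, Circle.coe_exp, Complex.norm_mul_exp_arg_mul_I]

theorem continuousOn_direction : ContinuousOn direction {z | z ≠ 0} := by
  have h : Topology.IsInducing (fun u : Circle => (u : ℂ)) := Topology.IsInducing.subtypeVal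
  rw [h.continuousOn_iff]
  have h1 : ContinuousOn (fun z : ℂ => z / (‖z‖ : ℂ)) {z | z ≠ 0} :=
    continuousOn_id.div (by fun_prop) fun z hz => by simpa using hz
  refine h1.congr fun z hz => ?_
  have hz' : (‖z‖ : ℂ) ≠ 0 := by simpa using hz
  rw [eq_div_iff hz', mul_comm]
  exact norm_mul_direction z

theorem norm_real_mul_circle {r : ℝ} (hr : 0 ≤ r) (u : Circle) : ‖(r : ℂ) * (u : ℂ)‖ = r := by
  rw [norm_mul, Circle.norm_coe, mul_one, Complex.norm_real, Real.norm_eq_abs, abs_of_nonneg hr]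

theorem direction_real_mul {r : ℝ} (hr : 0 < r) (u : Circle) :
    direction ((r : ℂ) * (u : ℂ)) = u := by
  apply Circle.ext
  have h := norm_mul_direction ((r : ℂ) * (u : ℂ))
  rw [norm_real_mul_circle hr.le] at h
  exact mul_left_cancel₀ (Complex.ofReal_ne_zero.2 (ne_of_gt hr)) h

/-- Multiplication by `2` on the disc of radius `1 / 2`. -/
def double (z : Disc) : Disc :=
  -- The `else` branch is a filler that keeps the map total.
  ⟨if ‖(z : ℂ)‖ ≤ 1 / 2 then 2 * (z : ℂ) else z, by
    rw [mem_closedBall_zero_iff]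
    split_ifs with h
    · rw [norm_mul, Complex.norm_ofNat]
      linarith
    · exact z.norm_le_one⟩

theorem coe_double {z : Disc} (hz : ‖(z : ℂ)‖ ≤ 1 / 2) : (double z : ℂ) = 2 * z := by
  simp only [double]
  exact if_pos hz

theorem norm_double {z : Disc} (hz : ‖(z : ℂ)‖ ≤ 1 / 2) : ‖(double z : ℂ)‖ = 2 * ‖(z : ℂ)‖ := by
  rw [coe_double hz, norm_mul, Complex.norm_ofNat]

theorem continuousOn_double : ContinuousOn double {z | ‖(z : ℂ)‖ ≤ 1 / 2} := by
  rw [Topology.IsInducing.subtypeVal.continuousOn_iff]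
  exact (by fun_prop : Continuous fun z : Disc => 2 * (z : ℂ)).continuousOn.congr
    fun z hz => coe_double hz

theorem continuous_polar : Continuous fun p : unitInterval × Circle => polar p.1 p.2 := by
  refine Continuous.subtype_mk ?_ _
  exact (by fun_prop : Continuous fun p : unitInterval × Circle => ((p.1 : ℝ) : ℂ)).mul
    (continuous_subtype_val.comp continuous_snd)

end Disc

namespace SolidTorus

/-- The radius at which the collar of the new disc is found. -/
def collarRadius (ρ : ℝ) : unitInterval :=
  Set.projIcc 0 1 zero_le_one (max (1 - ρ) (3 / 2 - 2 * ρ))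

/-- For `1/4 ≤ ρ ≤ 1/2` the maximum is `3/2 - 2ρ`, falling from `1` to `1/2` while the direction is
rotated. For `ρ ≥ 1/2` it is `1 - ρ`, falling to `0` as the collar of the half-size solid torus
requires. -/
theorem coe_collarRadius {ρ : ℝ} (h : 1 / 4 ≤ ρ) (h1 : ρ ≤ 1) :
    (collarRadius ρ : ℝ) = max (1 - ρ) (3 / 2 - 2 * ρ) := by
  rw [collarRadius, Set.projIcc_of_mem]
  exact ⟨le_max_of_le_left (by linarith), max_le (by linarith) (by linarith)⟩

theorem collarRadius_injOn {ρ ρ' : ℝ} (h : 1 / 4 ≤ ρ) (h1 : ρ ≤ 1) (h' : 1 / 4 ≤ ρ') (h1' : ρ' ≤ 1)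
    (heq : (collarRadius ρ : ℝ) = collarRadius ρ') : ρ = ρ' := by
  rw [coe_collarRadius h h1, coe_collarRadius h' h1'] at heq
  rcases max_cases (1 - ρ) (3 / 2 - 2 * ρ) with h2 | h2 <;>
    rcases max_cases (1 - ρ') (3 / 2 - 2 * ρ') with h3 | h3 <;> linarith

/-- The direction in which the collar of the new disc is found: an isotopy from the direction
`e^{i φ(u)}` to the direction `1`. -/
def collarDir (φ : Circle → ℝ) (z : ℂ) : Circle :=
  Circle.exp (Set.projIcc (0 : ℝ) 1 zero_le_one (2 - 4 * ‖z‖) * φ (Disc.direction z))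

/-- The collar of the new disc, in the coordinates of the solid torus. -/
def collar (q : ℤ) (φ : Circle → ℝ) (z : ℂ) : SolidTorus :=
  (Disc.direction z * Circle.exp (cutAngle q (collarDir φ z)),
    Disc.polar (collarRadius ‖z‖) (collarDir φ z))

theorem collarDir_eq_one (φ : Circle → ℝ) {z : ℂ} (hz : 1 / 2 ≤ ‖z‖) : collarDir φ z = 1 := by
  rw [collarDir, Set.projIcc_of_le_left _ (by linarith)]
  simp

theorem cutAngle_one (q : ℤ) : cutAngle q ((1 : Circle) : ℂ) = 0 := by
  simp [cutAngle]

/-- Continuity depends on `collar` evaluating `cutAngle` at the unit direction and not at the point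
of smaller radius, where the exponential of the angle would jump. -/
theorem continuousOn_collar (q : ℤ) {φ : Circle → ℝ} (hφ : Continuous φ) :
    ContinuousOn (collar q φ) {z | z ≠ 0} := by
  have h1 : ContinuousOn (collarDir φ) {z | z ≠ 0} := by
    refine Circle.exp.continuous.comp_continuousOn (ContinuousOn.mul ?_
      (hφ.comp_continuousOn Disc.continuousOn_direction))
    exact (continuous_subtype_val.comp (continuous_projIcc.comp (by fun_prop))).continuousOn
  refine (Disc.continuousOn_direction.mul
    ((continuous_exp_cutAngle q).comp_continuousOn h1)).prodMk ?_
  refine Disc.continuous_polar.comp_continuousOn (ContinuousOn.prodMk ?_ h1)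
  exact ((continuous_projIcc (h := zero_le_one' ℝ)).comp
    (by fun_prop : Continuous fun z : ℂ => max (1 - ‖z‖) (3 / 2 - 2 * ‖z‖))).continuousOn

theorem norm_collar (q : ℤ) (φ : Circle → ℝ) (z : ℂ) :
    ‖((collar q φ z).2 : ℂ)‖ = collarRadius ‖z‖ :=
  Disc.norm_polar _ _

theorem collar_injOn (q : ℤ) (φ : Circle → ℝ) :
    Set.InjOn (collar q φ) {z | 1 / 4 ≤ ‖z‖ ∧ ‖z‖ ≤ 1} := by
  rintro z ⟨hz, hz1⟩ z' ⟨hz', hz1'⟩ heq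
  have hn : ‖z‖ = ‖z'‖ := by
    refine collarRadius_injOn hz hz1 hz' hz1' ?_
    rw [← norm_collar q φ, ← norm_collar q φ, heq]
  have hdir : collarDir φ z = collarDir φ z' := by
    -- Where the collar radius may vanish the direction is already `1`; elsewhere it can be read off
    -- the disc coordinate.
    rcases le_or_gt (1 / 2) ‖z‖ with h | h
    · rw [collarDir_eq_one φ h, collarDir_eq_one φ (hn ▸ h)]
    · have h2 : (collarRadius ‖z‖ : ℝ) ≠ 0 := by
        rw [coe_collarRadius hz hz1]
        exact (lt_of_lt_of_le (by linarith) (le_max_left _ _)).ne'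
      have h3 := congrArg (fun p : SolidTorus => (p.2 : ℂ)) heq
      simp only [collar, Disc.coe_polar, ← hn] at h3
      exact Circle.ext (mul_left_cancel₀ (Complex.ofReal_ne_zero.2 h2) h3)
  have hd : Disc.direction z = Disc.direction z' := by
    have h3 := congrArg (fun p : SolidTorus => p.1) heq
    simp only [collar, hdir] at h3
    exact mul_right_cancel h3
  rw [← Disc.norm_mul_direction z, ← Disc.norm_mul_direction z', hn, hd]

end SolidTorus

namespace SpanningDisc

variable {γ : Circle → S} {A : AnnularNbhd γ} {t₀ : unitInterval} {h : S ≃ₜ S}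
  {N : RegularNbhd A t₀} (D : SpanningDisc h N)

theorem exists_toFun_eq {z : Disc} (hz : 1 / 2 ≤ ‖(z : ℂ)‖) : ∃ p : SolidTorus,
    D.toFun z = OpenBook.mk h (N.toFun p) ∧ ‖(p.2 : ℂ)‖ = 2 * (1 - ‖(z : ℂ)‖) := by
  have h1 := z.norm_le_one
  refine ⟨(Disc.direction z, Disc.polar ⟨2 * (1 - ‖(z : ℂ)‖), by linarith, by linarith⟩
    (D.dir (Disc.direction z))), D.collar z _ _ ?_, Disc.norm_polar _ _⟩
  conv_lhs => rw [← Disc.norm_mul_direction z]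
  congr 2
  ring

theorem mem_carrier_iff {z : Disc} : D.toFun z ∈ N.carrier h ↔ 1 / 2 ≤ ‖(z : ℂ)‖ := by
  refine ⟨fun hz => not_lt.1 fun hlt => D.notMem z hlt hz, fun hz => ?_⟩
  obtain ⟨p, hp, -⟩ := D.exists_toFun_eq hz
  exact ⟨p, hp.symm⟩

theorem notMem_openCarrier {z : Disc} (hz : ‖(z : ℂ)‖ ≤ 1 / 2) :
    D.toFun z ∉ N.openCarrier h := by
  rcases hz.lt_or_eq with hlt | heq
  · exact fun hmem => D.notMem z hlt (Set.image_subset_range _ _ hmem)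
  · obtain ⟨p, hp, hn⟩ := D.exists_toFun_eq heq.ge
    rw [hp, N.mk_toFun_mem_openCarrier, hn, heq]
    norm_num

section twist

variable [T2Space S] (q : ℤ) {h' : S ≃ₜ S} (hh' : ∀ x, h' x = A.twistFun q (h x))
  (φ : Circle → ℝ)

/-- The disc `D` after the cut, with a new collar. -/
def twistFun (z : Disc) : OpenBook h' :=
  if ‖(z : ℂ)‖ < 1 / 4 then
    OpenBook.cutMap A N.zero_lt_level q hh' (D.toFun (Disc.double z))
  else OpenBook.mk h' ((N.twist q).toFun (SolidTorus.collar q φ z))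

theorem twistFun_of_le {z : Disc} (hz : 1 / 4 ≤ ‖(z : ℂ)‖) :
    D.twistFun q hh' φ z = OpenBook.mk h' ((N.twist q).toFun (SolidTorus.collar q φ z)) :=
  if_neg (not_lt.2 hz)

/-- The content is the circle `‖z‖ = 1/4`: doubling takes it to the circle where `D` crosses `∂N`,
and there the isotopy still has direction `dir`. -/
theorem twistFun_of_ge (hφ : ∀ u, D.dir u = Circle.exp (φ u)) {z : Disc}
    (hz : ‖(z : ℂ)‖ ≤ 1 / 4) : D.twistFun q hh' φ z =
      OpenBook.cutMap A N.zero_lt_level q hh' (D.toFun (Disc.double z)) := by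
  rcases hz.lt_or_eq with hlt | heq
  · exact if_pos hlt
  · have h2 : ((Disc.double z : Disc) : ℂ) =
        ((1 - ((1 : unitInterval) : ℝ) / 2 : ℝ) : ℂ) * (Disc.direction z : ℂ) := by
      rw [Disc.coe_double (by linarith), ← Disc.norm_mul_direction z, heq,
        Disc.direction_real_mul (by norm_num)]
      push_cast
      ring
    have hdir : SolidTorus.collarDir φ z = D.dir (Disc.direction z) := by
      rw [SolidTorus.collarDir, heq, hφ]
      norm_num
    have hrad : SolidTorus.collarRadius ‖(z : ℂ)‖ = 1 := by
      apply Subtype.ext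
      rw [SolidTorus.coe_collarRadius heq.ge z.norm_le_one, heq]
      norm_num
    rw [D.twistFun_of_le q hh' φ heq.ge, D.collar _ _ _ h2, N.cutMap_mk_toFun]
    congr 2
    rw [SolidTorus.collar, hdir, hrad]
    refine Prod.ext ?_ rfl
    simp [SolidTorus.cut]

theorem continuous_twistFun (hφ : ∀ u, D.dir u = Circle.exp (φ u)) (hφc : Continuous φ) :
    Continuous (D.twistFun q hh' φ) := by
  have h1 : ContinuousOn (D.twistFun q hh' φ) {z | ‖(z : ℂ)‖ ≤ 1 / 4} := by
    have h2 : ContinuousOn (fun z : Disc => OpenBook.cutMap A N.zero_lt_level q hh'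
        (D.toFun (Disc.double z))) {z | ‖(z : ℂ)‖ ≤ 1 / 4} := by
      refine (N.continuousOn_cutMap q N.zero_lt_level hh').comp
        (D.continuous_toFun.comp_continuousOn (Disc.continuousOn_double.mono ?_)) ?_
      · intro z (hz : ‖(z : ℂ)‖ ≤ 1 / 4)
        exact hz.trans (by norm_num)
      · intro z (hz : ‖(z : ℂ)‖ ≤ 1 / 4)
        refine D.notMem_openCarrier ?_
        rw [Disc.norm_double (by linarith)]
        linarith
    exact h2.congr fun z hz => D.twistFun_of_ge q hh' φ hφ hz
  have h2 : ContinuousOn (D.twistFun q hh' φ) {z | 1 / 4 ≤ ‖(z : ℂ)‖} := by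
    have h3 : ContinuousOn (fun z : Disc => OpenBook.mk h' ((N.twist q).toFun
        (SolidTorus.collar q φ z))) {z | 1 / 4 ≤ ‖(z : ℂ)‖} := by
      refine ((N.twist q).continuous_mk_toFun h').comp_continuousOn
        ((SolidTorus.continuousOn_collar q hφc).comp continuous_subtype_val.continuousOn ?_)
      intro z (hz : 1 / 4 ≤ ‖(z : ℂ)‖)
      exact norm_pos_iff.1 (by linarith)
    exact h3.congr fun z hz => D.twistFun_of_le q hh' φ hz
  have h3 := h1.union_of_isClosed h2 (isClosed_le (by fun_prop) continuous_const)
    (isClosed_le continuous_const (by fun_prop))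
  rw [← continuousOn_univ]
  exact h3.mono fun z _ => le_total ‖(z : ℂ)‖ (1 / 4)

theorem twistFun_mem_carrier_iff {z : Disc} :
    D.twistFun q hh' φ z ∈ (N.twist q).carrier h' ↔ 1 / 4 ≤ ‖(z : ℂ)‖ := by
  constructor
  · intro hz
    by_contra! hlt
    rw [twistFun, if_pos hlt, N.cutMap_mem_carrier_iff, D.mem_carrier_iff,
      Disc.norm_double (by linarith)] at hz
    linarith
  · intro hz
    rw [D.twistFun_of_le q hh' φ hz]
    exact ⟨_, rfl⟩

theorem twistFun_injective : Function.Injective (D.twistFun q hh' φ) := by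
  intro z z' hzz
  have hiff : 1 / 4 ≤ ‖(z : ℂ)‖ ↔ 1 / 4 ≤ ‖(z' : ℂ)‖ := by
    rw [← D.twistFun_mem_carrier_iff q hh' φ, hzz, D.twistFun_mem_carrier_iff q hh' φ]
  by_cases hz : 1 / 4 ≤ ‖(z : ℂ)‖
  · have hz' := hiff.1 hz
    rw [D.twistFun_of_le q hh' φ hz, D.twistFun_of_le q hh' φ hz'] at hzz
    exact Subtype.ext (SolidTorus.collar_injOn q φ ⟨hz, z.norm_le_one⟩ ⟨hz', z'.norm_le_one⟩
      ((N.twist q).mk_toFun_injective h' hzz))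
  · have hz' : ¬ 1 / 4 ≤ ‖(z' : ℂ)‖ := fun h => hz (hiff.2 h)
    rw [not_le] at hz hz'
    rw [twistFun, twistFun, if_pos hz, if_pos hz'] at hzz
    have h1 := congrArg (fun z : Disc => (z : ℂ))
      (D.injective_toFun (RegularNbhd.cutMap_injective q hh' N.zero_lt_level hzz))
    rw [Disc.coe_double (by linarith), Disc.coe_double (by linarith)] at h1
    exact Subtype.ext (mul_left_cancel₀ two_ne_zero h1)

/-- The disc `D` after the cut, with a new collar, as a spanning disc for the concentric
neighbourhood of half the radius. -/
def twist (hφ : ∀ u, D.dir u = Circle.exp (φ u)) (hφc : Continuous φ) :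
    SpanningDisc h' (N.twist q).half where
  toFun := D.twistFun q hh' φ
  continuous_toFun := D.continuous_twistFun q hh' φ hφ hφc
  injective_toFun := D.twistFun_injective q hh' φ
  dir _ := 1
  continuous_dir := continuous_const
  collar z u s hz := by
    have hs0 := s.2.1
    have hs1 := s.2.2
    have hn : ‖(z : ℂ)‖ = 1 - (s : ℝ) / 2 := by
      rw [hz, Disc.norm_real_mul_circle (by linarith)]
    have hu : Disc.direction z = u := by rw [hz, Disc.direction_real_mul (by linarith)]
    rw [D.twistFun_of_le q hh' φ (by linarith)]
    change _ = OpenBook.mk h' ((N.twist q).toFun (u, Disc.halve (Disc.polar s 1)))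
    congr 2
    rw [SolidTorus.collar, SolidTorus.collarDir_eq_one φ (by linarith), hu,
      SolidTorus.cutAngle_one, Circle.exp_zero, mul_one]
    refine Prod.ext rfl (Subtype.ext ?_)
    simp only [Disc.coe_polar, Disc.coe_halve]
    rw [SolidTorus.coe_collarRadius (by linarith) z.norm_le_one, max_eq_left (by linarith), hn]
    push_cast
    ring
  notMem z hz := by
    rintro ⟨p, hp⟩
    have hp' : D.twistFun q hh' φ z =
        OpenBook.mk h' ((N.twist q).toFun (p.1, Disc.halve p.2)) := hp.symm
    have hq : 1 / 4 ≤ ‖(z : ℂ)‖ := (D.twistFun_mem_carrier_iff q hh' φ).1 ⟨_, hp'.symm⟩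
    rw [D.twistFun_of_le q hh' φ hq] at hp'
    have h1 := congrArg (fun p : SolidTorus => ‖(p.2 : ℂ)‖)
      ((N.twist q).mk_toFun_injective h' hp')
    simp only [SolidTorus.norm_collar, Disc.coe_halve, norm_div, Complex.norm_ofNat] at h1
    rw [SolidTorus.coe_collarRadius hq z.norm_le_one] at h1
    -- For `‖z‖ < 1/2` this makes the radius exceed `1/2`, the radius of the half-size solid torus.
    have h2 := le_max_right (1 - ‖(z : ℂ)‖) (3 / 2 - 2 * ‖(z : ℂ)‖)
    have h3 := p.2.norm_le_one
    linarith

theorem range_twistFun_diff_carrier (hφ : ∀ u, D.dir u = Circle.exp (φ u)) :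
    Set.range (D.twistFun q hh' φ) \ (N.twist q).carrier h' =
      OpenBook.cutMap A N.zero_lt_level q hh' '' (Set.range D.toFun \ N.carrier h) := by
  ext b
  constructor
  · rintro ⟨⟨z, rfl⟩, hz⟩
    rw [D.twistFun_mem_carrier_iff, not_le] at hz
    rw [D.twistFun_of_ge q hh' φ hφ hz.le]
    refine ⟨_, ⟨⟨_, rfl⟩, ?_⟩, rfl⟩
    rw [D.mem_carrier_iff, Disc.norm_double (by linarith)]
    linarith
  · rintro ⟨_, ⟨⟨z, rfl⟩, hz⟩, rfl⟩
    refine ⟨?_, fun hmem => hz ((N.cutMap_mem_carrier_iff q hh').1 hmem)⟩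
    rw [D.mem_carrier_iff, not_le] at hz
    have h1 : ‖(Disc.halve z : ℂ)‖ = ‖(z : ℂ)‖ / 2 := by
      rw [Disc.coe_halve, norm_div, Complex.norm_ofNat]
    refine ⟨Disc.halve z, ?_⟩
    rw [D.twistFun_of_ge q hh' φ hφ (by linarith)]
    congr 2
    apply Subtype.ext
    rw [Disc.coe_double (by linarith), Disc.coe_halve]
    ring

end twist

/-- The page curve has constant second coordinate, so `λ_S` has no `μ`-component; the degree of
`dir` is the `μ`-component of `λ_D`, which equals `λ_S`. -/
theorem hasDegree_dir_of_hasTwisting_zero (htw : D.HasTwisting 0) : HasDegree D.dir 0 := by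
  obtain ⟨lamS, lamD, ⟨hS, -⟩, ⟨hD, -⟩, heq⟩ := htw
  have h1 : lamS.1 = 0 := hS.unique hasDegree_const_one
  rw [zero_smul, add_zero] at heq
  rw [← h1, heq]
  exact hD

end SpanningDisc

end Stallings

end

/-! ### The surgery theorem -/

theorem mainTheorem12 {S : Type*} [TopologicalSpace S] [T2Space S] [CompactSpace S]
    [ChartedSpace (EuclideanHalfSpace 2) S]
    -- `S` is a compact oriented surface, each component of which has non-empty boundary
    (hS : ∀ x : S, (connectedComponent x ∩ (𝓡∂ 2).boundary S).Nonempty)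
    (o : Stallings.SurfaceOrientation S)
    -- the monodromy
    (h : S ≃ₜ S) (hh : ∀ x ∈ (𝓡∂ 2).boundary S, h x = x)
    -- the curve `C`, its annular neighbourhood in the page and its neighbourhood in `M`
    {γ : Circle → S} (A : Stallings.AnnularNbhd γ) (hA : A.IsPositive o)
    (t₀ : unitInterval) (N : Stallings.RegularNbhd A t₀)
    -- the disc `D`, with longitude `λ_D`
    (D : Stallings.SpanningDisc h N) (lamD : Stallings.TorusH1)
    (hlamD : Stallings.HasClass D.longitudeCurve lamD) (htw : D.HasTwisting 0)
    -- the surgery with slope `p μ + q λ_D`, where `p = -1`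
    (q : ℤ) (B : Matrix (Fin 2) (Fin 2) ℤ)
    (hB : Stallings.IsGluingOfSlope B ((-1 : ℤ) • Stallings.meridian + q • lamD)) :
    ∃ Φ : Stallings.Surgery h N B ≃ₜ Stallings.OpenBook (A.dehnTwist ^ q * h),
      -- outside the glued-in solid torus, pages correspond to pages
      (∀ (x : S) (t : unitInterval) (hx : Stallings.OpenBook.mk h (x, t) ∉ N.openCarrier h),
        ∃ y : S, Φ (Stallings.Surgery.ofExterior h N B ⟨_, hx⟩) =
          Stallings.OpenBook.mk (A.dehnTwist ^ q * h) (y, t)) ∧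
      -- and the page which contains `C` corresponds to itself by the identity
      (∀ (x : S) (hx : Stallings.OpenBook.mk h (x, t₀) ∉ N.openCarrier h),
        Φ (Stallings.Surgery.ofExterior h N B ⟨_, hx⟩) =
          Stallings.OpenBook.mk (A.dehnTwist ^ q * h) (x, t₀)) ∧
      -- `C` bounds an embedded disc in the new open book, it has a regular neighbourhood in the
      -- glued-in solid torus, outside of which the new disc is `D`, and its twisting is zero
      ∃ (A' : Stallings.AnnularNbhd γ) (N' : Stallings.RegularNbhd A' t₀)
        (D' : Stallings.SpanningDisc (A.dehnTwist ^ q * h) N'),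
        A'.IsShrinkingOf A ∧
        N'.carrier (A.dehnTwist ^ q * h) ⊆ Φ '' Stallings.Surgery.newTorus h N B ∧
        Set.range D'.toFun \ Φ '' Stallings.Surgery.newTorus h N B =
          (fun x => Φ (Stallings.Surgery.ofExterior h N B x)) ''
            {x | x.1 ∈ Set.range D.toFun \ N.carrier h} ∧
        D'.HasTwisting 0 := by
  have hdeg := D.hasDegree_dir_of_hasTwisting_zero htw
  obtain ⟨φ, hφc, hφ⟩ := hdeg.exists_lift
  -- Twisting zero forces `λ_D = (0, 1)`.
  have hlam : (-1 : ℤ) • Stallings.meridian + q • lamD = (-1, q) := by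
    have h1 : lamD.1 = 0 := hlamD.1.unique hdeg
    have h2 : lamD.2 = 1 := hlamD.2.unique Stallings.hasDegree_id
    ext <;> simp [Stallings.meridian, h1, h2]
  rw [hlam] at hB
  obtain ⟨Ψ, hΨ, hΨB⟩ := Stallings.SolidTorus.exists_extension q B hB
  have hh' : ∀ x, (A.dehnTwist ^ q * h) x = A.twistFun q (h x) := fun x =>
    A.dehnTwist_zpow_apply q (h x)
  obtain ⟨Φ, hΦ, hΦV⟩ :=
    Stallings.Surgery.exists_homeomorph_openBook N B q hh' Ψ hΨ hΨB
  -- The cut map preserves levels, hence pages, and it does not move level `t₀`.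
  refine ⟨Φ, fun x t hx => ⟨(A.cutFun t₀ q (x, t)).1, hΦ _⟩, fun x hx => ?_, A.half,
    (N.twist q).half, D.twist q hh' φ hφ hφc, ?_, ?_, ?_, ?_⟩
  · rw [hΦ, Stallings.OpenBook.cutMap_mk, A.cutFun_of_le t₀ q le_rfl]
  · refine ⟨1 / 2, by norm_num, by norm_num, fun u s s' hs => ?_⟩
    refine congrArg A.toFun (Prod.ext rfl (Subtype.ext ?_))
    rw [Stallings.AnnularNbhd.coe_halve, hs]
    ring
  · rw [hΦV]
    rintro _ ⟨p, rfl⟩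
    exact ⟨_, rfl⟩
  · rw [hΦV]
    refine (D.range_twistFun_diff_carrier q hh' φ hφ).trans ?_
    ext b
    constructor
    · rintro ⟨x, hx, rfl⟩
      exact ⟨⟨x, fun hx' => hx.2 (Set.image_subset_range _ _ hx')⟩, hx, hΦ _⟩
    · rintro ⟨x, hx, rfl⟩
      exact ⟨x.1, hx, (hΦ x).symm⟩
  -- The new disc has constant direction `1`, so its longitude is the page curve itself.
  · exact ⟨(0, 1), (0, 1), ⟨Stallings.hasDegree_const_one, Stallings.hasDegree_id⟩,
      ⟨Stallings.hasDegree_const_one, Stallings.hasDegree_id⟩, by simp⟩
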